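/- Let $\alpha>0$ and $\varphi(x)=(x^2+1)^{-1}$, $x\in\mathbb R$. Let $\boldsymbol H$ be the Hilbert transform on $L^2(\mathbb R)$, $\boldsymbol Hg=-\mathrm i g_++\mathrm i g_-$, where $g_\pm$ are the orthogonal projections of $g$ onto the Hardy spaces $H^2(\mathbb C_\pm)$ of the upper and lower half-planes (the $L^2$ functions whose Fourier transform is supported in $[0,\infty)$, respectively $(-\infty,0]$); that is, $\boldsymbol H$ is the Fourier multiplier with symbol $-\mathrm i\,\mathrm{sgn}\,\xi$. Let $M_\varphi$ denote multiplication by $\varphi$, and let $L^2_{\rm e}(\mathbb R)$ be the Hilbert space of even functions in $L^2(\mathbb R)$. It is invariant under $M_\varphi$ and $\boldsymbol H^{-1}M_\varphi\boldsymbol H$, and we define the bounded operators $A$ and $B$ on $L^2_{\rm e}(\mathbb R)$ by $$Ag=\boldsymbol H^{-1}M_\varphi\boldsymbol Hg,\qquad Bg=\varphi g .$$ Then $A$ and $B$ are self-adjoint, and (i) $\operatorname{rank}(A-B)=1$; (ii) there exists a real bounded function $h\in\Lambda_\alpha(\mathbb R)$ such that $$s_n\big(h(A)-h(B)\big)\ge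 (n+1)^{-\alpha},\qquad n\ge0 .$$ Here $s_n(T)=\inf\{\|T-R\|:\operatorname{rank}R\le n\}$ are the singular values of $T$, and $\Lambda_\alpha(\mathbb R)$ is the Hölder–Zygmund class of continuous functions $f$ on $\mathbb R$ such that $|(\Delta_t^mf)(x)|\le \mathrm{const}\,|t|^\alpha$ for all $t,x\in\mathbb R$, where $(\Delta_tf)(x)=f(x+t)-f(x)$ and $m=\lfloor\alpha\rfloor+1$ is the least integer greater than $\alpha$. -/

import Mathlib

open MeasureTheory FourierTransform
open scoped ENNReal

noncomputable section

namespace HilbertSharpness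

/-- The complex Hilbert space `L²(ℝ)`. -/
abbrev L2 : Type := Lp ℂ 2 (volume : Measure ℝ)

/-- The operator `M_φ` of multiplication by a function `φ ∈ L^∞(ℝ)` on `L²(ℝ)`. -/
def mulOp (φ : ℝ → ℂ) (hφ : MemLp φ ∞ volume) : L2 →L[ℂ] L2 :=
  (ContinuousLinearMap.mul ℂ ℂ).holderL volume ∞ 2 2 (hφ.toLp φ)

theorem coeFn_mulOp (φ : ℝ → ℂ) (hφ : MemLp φ ∞ volume) (f : L2) :
    mulOp φ hφ f =ᵐ[volume] fun x => φ x * f x := by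
  have h1 : mulOp φ hφ f =ᵐ[volume] fun x => (hφ.toLp φ) x * f x :=
    (ContinuousLinearMap.mul ℂ ℂ).coeFn_holder (hφ.toLp φ) f
  filter_upwards [h1, hφ.coeFn_toLp] with x hx hx'
  rw [hx, hx']

/-- The operator `𝓕⁻¹ M_m 𝓕` on `L²(ℝ)`, where `(𝓕 f)(ξ) = ∫ f(x) e^{-2πixξ} dx`. -/
def fourierMult (m : ℝ → ℂ) (hm : MemLp m ∞ volume) : L2 →L[ℂ] L2 :=
  ((Lp.fourierTransformₗᵢ ℝ ℂ).symm : L2 →L[ℂ] L2) ∘L mulOp m hm ∘L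
    (Lp.fourierTransformₗᵢ ℝ ℂ : L2 →L[ℂ] L2)

theorem fourier_fourierMult (m : ℝ → ℂ) (hm : MemLp m ∞ volume) (f : L2) :
    Lp.fourierTransformₗᵢ ℝ ℂ (fourierMult m hm f) =
      mulOp m hm (Lp.fourierTransformₗᵢ ℝ ℂ f) := by
  simp [fourierMult]

theorem memLp_indicator_one {s : Set ℝ} (hs : MeasurableSet s) :
    MemLp (s.indicator fun _ => (1 : ℂ)) ∞ volume :=
  (memLp_top_const (1 : ℂ)).indicator hs

/-- The orthogonal projection `P₊` of `L²(ℝ)` onto the Hardy space `H²(ℂ₊)` of the upper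
half-plane, i.e. the subspace of functions with Fourier transform supported on `[0, ∞)`. -/
def projPlus : L2 →L[ℂ] L2 :=
  fourierMult ((Set.Ioi 0).indicator fun _ => 1) (memLp_indicator_one measurableSet_Ioi)

/-- The orthogonal projection `P₋` of `L²(ℝ)` onto the Hardy space `H²(ℂ₋)` of the lower
half-plane, i.e. the subspace of functions with Fourier transform supported on `(-∞, 0]`. -/
def projMinus : L2 →L[ℂ] L2 :=
  fourierMult ((Set.Iio 0).indicator fun _ => 1) (memLp_indicator_one measurableSet_Iio)

/-- The Hilbert transform `H = -i P₊ + i P₋` as a bounded operator, that is, the Fourier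
multiplier with symbol `-i sgn ξ`. -/
def hilbertCLM : L2 →L[ℂ] L2 := -Complex.I • projPlus + Complex.I • projMinus

theorem fourier_hilbertCLM (f : L2) :
    Lp.fourierTransformₗᵢ ℝ ℂ (hilbertCLM f) =ᵐ[volume]
      fun ξ => -Complex.I * (SignType.sign ξ : ℂ) * Lp.fourierTransformₗᵢ ℝ ℂ f ξ := by
  have h : Lp.fourierTransformₗᵢ ℝ ℂ (hilbertCLM f) =
      -Complex.I • mulOp _ (memLp_indicator_one (measurableSet_Ioi (a := (0 : ℝ)))) (Lp.fourierTransformₗᵢ ℝ ℂ f)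
      + Complex.I •
        mulOp _ (memLp_indicator_one (measurableSet_Iio (a := (0 : ℝ)))) (Lp.fourierTransformₗᵢ ℝ ℂ f) := by
    rw [← fourier_fourierMult, ← fourier_fourierMult]
    simp only [hilbertCLM, projPlus, projMinus, add_apply, smul_apply, map_add, map_smul]
  rw [h]
  filter_upwards [Lp.coeFn_add
      (-Complex.I • mulOp _ (memLp_indicator_one (measurableSet_Ioi (a := (0 : ℝ)))) (Lp.fourierTransformₗᵢ ℝ ℂ f))
      (Complex.I • mulOp _ (memLp_indicator_one (measurableSet_Iio (a := (0 : ℝ)))) (Lp.fourierTransformₗᵢ ℝ ℂ f)),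
    Lp.coeFn_smul (-Complex.I)
      (mulOp _ (memLp_indicator_one (measurableSet_Ioi (a := (0 : ℝ)))) (Lp.fourierTransformₗᵢ ℝ ℂ f)),
    Lp.coeFn_smul Complex.I
      (mulOp _ (memLp_indicator_one (measurableSet_Iio (a := (0 : ℝ)))) (Lp.fourierTransformₗᵢ ℝ ℂ f)),
    coeFn_mulOp _ (memLp_indicator_one (measurableSet_Ioi (a := (0 : ℝ)))) (Lp.fourierTransformₗᵢ ℝ ℂ f),
    coeFn_mulOp _ (memLp_indicator_one (measurableSet_Iio (a := (0 : ℝ)))) (Lp.fourierTransformₗᵢ ℝ ℂ f)]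
    with ξ h1 h2 h3 h4 h5
  rw [h1, Pi.add_apply, h2, h3, Pi.smul_apply, Pi.smul_apply, h4, h5]
  rcases lt_trichotomy ξ 0 with hξ | hξ | hξ
  · simp [hξ, not_lt.2 hξ.le]
  · simp [hξ]
  · simp [hξ, not_lt.2 hξ.le]

theorem hilbertCLM_hilbertCLM (f : L2) : hilbertCLM (hilbertCLM f) = -f := by
  apply (Lp.fourierTransformₗᵢ ℝ ℂ).injective
  rw [map_neg]
  apply Lp.ext
  have h0 : ∀ᵐ ξ : ℝ, ξ ≠ 0 := by simp [ae_iff]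
  filter_upwards [fourier_hilbertCLM (hilbertCLM f), fourier_hilbertCLM f, h0,
    Lp.coeFn_neg (Lp.fourierTransformₗᵢ ℝ ℂ f)] with ξ h1 h2 h3 h4
  rw [h1, h2, h4, Pi.neg_apply]
  rcases lt_or_gt_of_ne h3 with hξ | hξ
  · simp [hξ, ← mul_assoc]
  · simp [hξ, ← mul_assoc]

/-- The Hilbert transform `H` as an invertible operator on `L²(ℝ)`. -/
def hilbert : L2 ≃L[ℂ] L2 :=
  ContinuousLinearEquiv.equivOfInverse hilbertCLM (-hilbertCLM)
    (fun f => by simp [hilbertCLM_hilbertCLM]) (fun f => by simp [hilbertCLM_hilbertCLM])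

/-- The reflection `(R f)(x) = f(-x)` on `L²(ℝ)`. -/
def reflect : L2 →L[ℂ] L2 :=
  (Lp.compMeasurePreservingₗᵢ ℂ (fun x : ℝ => -x)
    (Measure.measurePreserving_neg volume)).toContinuousLinearMap

theorem coeFn_reflect (f : L2) : reflect f =ᵐ[volume] fun x => f (-x) :=
  Lp.coeFn_compMeasurePreserving f (Measure.measurePreserving_neg volume)

/-- The subspace `L²ₑ(ℝ)` of even functions in `L²(ℝ)`. -/
def evenL2 : Submodule ℂ L2 where
  carrier := {f | ∀ᵐ x : ℝ, f (-x) = f x}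
  add_mem' {f g} hf hg := by
    have h := Lp.coeFn_add f g
    have h' := (Measure.measurePreserving_neg (volume : Measure ℝ)).quasiMeasurePreserving.ae h
    filter_upwards [hf, hg, h, h'] with x h1 h2 h3 h4
    simp only [Pi.add_apply] at h3 h4
    rw [h3, h4, h1, h2]
  zero_mem' := by
    have h := Lp.coeFn_zero ℂ 2 (volume : Measure ℝ)
    have h' := (Measure.measurePreserving_neg (volume : Measure ℝ)).quasiMeasurePreserving.ae h
    filter_upwards [h, h'] with x h1 h2
    rw [h1, h2]; rfl
  smul_mem' c f hf := by
    have h := Lp.coeFn_smul c f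
    have h' := (Measure.measurePreserving_neg (volume : Measure ℝ)).quasiMeasurePreserving.ae h
    filter_upwards [hf, h, h'] with x h1 h3 h4
    simp only [Pi.smul_apply] at h3 h4
    rw [h3, h4, h1]

theorem mem_evenL2_iff (f : L2) : f ∈ evenL2 ↔ reflect f = f := by
  constructor
  · intro hf
    apply Lp.ext
    filter_upwards [coeFn_reflect f, hf] with x h1 h2
    rw [h1, h2]
  · intro hf
    have h := coeFn_reflect f
    rw [hf] at h
    exact h.symm

theorem isClosed_evenL2 : IsClosed (evenL2 : Set L2) := by
  have : (evenL2 : Set L2) = {f | reflect f = f} := Set.ext mem_evenL2_iff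
  rw [this]
  exact isClosed_eq reflect.continuous continuous_id

instance : CompleteSpace evenL2 := isClosed_evenL2.completeSpace_coe

theorem reflect_toLp (g : SchwartzMap ℝ ℂ) :
    reflect (g.toLp 2) =
      (SchwartzMap.compCLMOfContinuousLinearEquiv ℂ (ContinuousLinearEquiv.neg ℝ) g).toLp 2 :=
  rfl

theorem fourier_reflect (f : L2) :
    Lp.fourierTransformₗᵢ ℝ ℂ (reflect f) = reflect (Lp.fourierTransformₗᵢ ℝ ℂ f) := by
  apply DenseRange.induction_on
    (p := fun f => Lp.fourierTransformₗᵢ ℝ ℂ (reflect f) = reflect (Lp.fourierTransformₗᵢ ℝ ℂ f))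
    (SchwartzMap.denseRange_toLpCLM (F := ℂ) (E := ℝ) (p := 2) (μ := volume)
      ENNReal.ofNat_ne_top) f
  · exact isClosed_eq
      ((Lp.fourierTransformₗᵢ ℝ ℂ).continuous.comp reflect.continuous)
      (reflect.continuous.comp (Lp.fourierTransformₗᵢ ℝ ℂ).continuous)
  · intro g
    change 𝓕 (reflect (g.toLp 2)) = reflect (𝓕 (g.toLp 2))
    rw [reflect_toLp, SchwartzMap.toLp_fourier_eq, SchwartzMap.toLp_fourier_eq, reflect_toLp]
    congr 1
    ext ξ
    have e := Real.fourier_comp_linearIsometry (LinearIsometryEquiv.neg ℝ (E := ℝ)) g ξ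
    exact e

theorem reflect_hilbertCLM (f : L2) : reflect (hilbertCLM f) = -hilbertCLM (reflect f) := by
  apply (Lp.fourierTransformₗᵢ ℝ ℂ).injective
  rw [map_neg, fourier_reflect]
  apply Lp.ext
  have q := (Measure.measurePreserving_neg (volume : Measure ℝ)).quasiMeasurePreserving
  filter_upwards [coeFn_reflect (Lp.fourierTransformₗᵢ ℝ ℂ (hilbertCLM f)),
    q.ae (fourier_hilbertCLM f), Lp.coeFn_neg (Lp.fourierTransformₗᵢ ℝ ℂ (hilbertCLM (reflect f))),
    fourier_hilbertCLM (reflect f), coeFn_reflect (Lp.fourierTransformₗᵢ ℝ ℂ f)]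
    with ξ h1 h2 h3 h4 h5
  rw [h1, h2, h3, Pi.neg_apply, h4, fourier_reflect, h5]
  simp [Left.sign_neg]

/-- The function `φ(x) = (x² + 1)⁻¹`. -/
def phi (x : ℝ) : ℂ := (((x ^ 2 + 1)⁻¹ : ℝ) : ℂ)

theorem memLp_phi : MemLp phi ∞ volume := by
  have hc : Continuous phi := by
    unfold phi
    exact Complex.continuous_ofReal.comp
      (Continuous.inv₀ (by fun_prop) (fun x => by positivity))
  refine memLp_top_of_bound hc.aestronglyMeasurable 1 (Filter.Eventually.of_forall fun x => ?_)
  rw [phi, Complex.norm_real, Real.norm_of_nonneg (by positivity)]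
  exact inv_le_one_of_one_le₀ (by nlinarith [sq_nonneg x])

theorem reflect_mulOp_phi (f : L2) :
    reflect (mulOp phi memLp_phi f) = mulOp phi memLp_phi (reflect f) := by
  apply Lp.ext
  have q := (Measure.measurePreserving_neg (volume : Measure ℝ)).quasiMeasurePreserving
  filter_upwards [coeFn_reflect (mulOp phi memLp_phi f), q.ae (coeFn_mulOp phi memLp_phi f),
    coeFn_mulOp phi memLp_phi (reflect f), coeFn_reflect f] with x h1 h2 h3 h4
  rw [h1, h2, h3, h4]
  simp [phi]

/-- The operator `H⁻¹ M_φ H` on `L²(ℝ)`. -/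
def conjOp : L2 →L[ℂ] L2 :=
  (hilbert.symm : L2 →L[ℂ] L2) ∘L mulOp phi memLp_phi ∘L (hilbert : L2 →L[ℂ] L2)

theorem conjOp_mem {f : L2} (hf : f ∈ evenL2) : conjOp f ∈ evenL2 := by
  rw [mem_evenL2_iff] at hf ⊢
  have h : ∀ g, conjOp g = -hilbertCLM (mulOp phi memLp_phi (hilbertCLM g)) := fun _ => rfl
  rw [h, map_neg, reflect_hilbertCLM, reflect_mulOp_phi, reflect_hilbertCLM, hf]
  simp

theorem mulOp_phi_mem {f : L2} (hf : f ∈ evenL2) : mulOp phi memLp_phi f ∈ evenL2 := by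
  rw [mem_evenL2_iff] at hf ⊢
  rw [reflect_mulOp_phi, hf]

/-- The operator `A g = H⁻¹ M_φ H g` on `L²ₑ(ℝ)`. -/
def opA : evenL2 →L[ℂ] evenL2 := conjOp.restrict fun _ => conjOp_mem

/-- The operator `B g = φ g` on `L²ₑ(ℝ)`. -/
def opB : evenL2 →L[ℂ] evenL2 := (mulOp phi memLp_phi).restrict fun _ => mulOp_phi_mem

/-- The singular values `s_n(T) = inf {‖T - R‖ : rank R ≤ n}`, `n ≥ 0`, of a bounded operator. -/
def singularValue {E : Type*} [NormedAddCommGroup E] [InnerProductSpace ℂ E]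
    (T : E →L[ℂ] E) (n : ℕ) : ℝ :=
  sInf {r : ℝ | ∃ R : E →L[ℂ] E, (R : E →ₗ[ℂ] E).rank ≤ n ∧ r = ‖T - R‖}

/-- The operator `h(T)` for a bounded self-adjoint operator `T` on a Hilbert space and a real
continuous function `h` (the continuous functional calculus). -/
def opFun {E : Type*} [NormedAddCommGroup E] [InnerProductSpace ℂ E] [CompleteSpace E]
    (h : ℝ → ℝ) (T : E →L[ℂ] E) : E →L[ℂ] E :=
  cfc h T

/-- The Hölder–Zygmund class `Λ_α(ℝ)`, `α > 0`: continuous functions `f` such that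
`|(Δ_t^m f)(x)| ≤ C |t|^α` for all `x, t`, where `(Δ_t f)(x) = f(x + t) - f(x)` and
`m = ⌊α⌋ + 1` is the least integer greater than `α`. -/
def MemHolderZygmund (α : ℝ) (f : ℝ → ℝ) : Prop :=
  Continuous f ∧ ∃ C : ℝ, ∀ t x : ℝ, |((fwdDiff t)^[⌊α⌋₊ + 1] f) x| ≤ C * |t| ^ α

end HilbertSharpness

end

/-!
The proof diagonalises the problem in the rational basis of the Hardy spaces and reads off singular
values from a Hankel matrix.

Let `z = (x - i) / (x + i)` be the Cayley transform and `e_n = z ^ n / (x + i)`, `n ∈ ℤ`. The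
function `(x + i) ^ (-k-1)` is the inverse Fourier transform of a multiple of `ξ ^ k e^{-2πξ}` on
`(0, ∞)`, so that `H e_n = -i e_n` for `n ≥ 0`, and by reflection `H e_n = i e_n` for `n < 0`
(`hilbertCLM_hardyLp_natCast`, `hilbertCLM_hardyLp_neg`). The even functions `e_n - e_{-n-1}`,
`n ≥ 0`, are orthogonal, and in this system `h(A) - h(B)` is the Hankel matrix with entries
`2 ∫ h(φ) (z ^ (n+m+1) + z ^ (-(n+m+1))) dx / (x² + 1)`. This is proved for polynomials `h`
(`inner_aeval_sub`) from the fact that `H` and the identity intertwine `A` and `B` with `M_φ`, and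
passes to uniform limits on `[0, 1]` (`tendsto_inner_aeval`), since both spectra lie in `[0, 1]`.

As `1 - 2 φ = (z + z⁻¹) / 2`, a Chebyshev polynomial `T_N(1 - 2 s)` has frequencies `± N`. The
function `h` is the lacunary series `∑ 2^{-αk} (1 - y²)₊ ^ M T_{N_k}(y)`, up to a constant, with
`y = 1 - 2 s`, `N_k = (2 M + 1) 2 ^ k` and `M = ⌊α⌋ + 2`. The factor `(1 - y²)₊ ^ M` removes the
loss of smoothness of Chebyshev polynomials at `± 1`: the derivatives of the `k`-th term of order
`⌊α⌋ + 1` are `O(N_k ^ (⌊α⌋ + 1))` (`hasDerivAt_cutDeriv`, `exists_bound_cutDeriv`), whence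
`h ∈ Λ_α` (`memHolderZygmund_tsum`). On the circle that factor is a trigonometric polynomial with
frequencies in `[-2 M, 2 M]`, so among multiples of `2 M + 1` the Fourier coefficients of `h(φ)`
are nonzero at the `± N_k` only (`integral_cutChebyshev`). Hence the Hankel matrix contains a
diagonal block of size `n + 1` with entries comparable to `2^{-αk}`, where `2 ^ k ~ n`, and an
operator of rank at most `n` cannot approximate it (`le_singularValue`).

For the rank of `A - B`, multiplication by `φ` is on the Fourier side convolution with
`π e^{-2π|·|}` (`fourier_mulOp_phi`). In `A - B` only opposite signs of the two frequencies
interact, where `e^{-2π|ξ - η|}` separates, and every even function is mapped to a multiple of `φ`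
(`opA_sub_opB_eq`).
-/

noncomputable section

namespace HilbertSharpness

open Set Filter Topology

/-! ### The Fourier transform on `L¹ ∩ L²` -/

theorem integral_fourier_mul_eq {f g : ℝ → ℂ} (hf : Integrable f) (hg : Integrable g) :
    ∫ ξ, 𝓕 f ξ * g ξ = ∫ x, f x * 𝓕 g x := by
  simpa using! VectorFourier.integral_fourierIntegral_smul_eq_flip (L := innerₗ ℝ)
    Real.continuous_fourierChar continuous_inner hf hg

theorem integral_fourierInv_mul_eq {f g : ℝ → ℂ} (hf : Integrable f) (hg : Integrable g) :
    ∫ ξ, 𝓕⁻ f ξ * g ξ = ∫ x, f x * 𝓕⁻ g x := by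
  have h := integral_fourier_mul_eq (hf.comp_neg) hg
  simp only [Real.fourierInv_eq_fourier_comp_neg f]
  rw [h, ← integral_neg_eq_self]
  simp [Real.fourierInv_eq_fourier_neg]

theorem continuous_fourier {f : ℝ → ℂ} (hf : Integrable f) : Continuous (𝓕 f) :=
  VectorFourier.fourierIntegral_continuous Real.continuous_fourierChar
    (L := innerₗ ℝ) continuous_inner hf

/-- On `L¹ ∩ L²` the `L²` Fourier transform is given by the Fourier integral. -/
theorem fourier_toLp_ae {f : ℝ → ℂ} (hf : Integrable f) (hf2 : MemLp f 2) :
    Lp.fourierTransformₗᵢ ℝ ℂ (hf2.toLp f) =ᵐ[volume] 𝓕 f := by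
  apply ae_eq_of_integral_contDiff_smul_eq
  · exact (Lp.memLp _).locallyIntegrable (by norm_num)
  · exact (continuous_fourier hf).locallyIntegrable
  · intro g g_smooth g_cpt
    have hg₁ : HasCompactSupport (Complex.ofRealCLM ∘ g) := g_cpt.comp_left rfl
    have hg₂ : ContDiff ℝ (⊤ : ℕ∞) (Complex.ofRealCLM ∘ g) := by fun_prop
    set ψ := hg₁.toSchwartzMap hg₂ with hψ
    have hψ' : ∀ x, ψ x = (g x : ℂ) := fun x => rfl
    have h1 := congrArg (fun T => T ψ) (Lp.fourier_toTemperedDistribution_eq (hf2.toLp f))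
    simp only [TemperedDistribution.fourier_apply, Lp.toTemperedDistribution_apply] at h1
    have h2 := integral_fourier_mul_eq ψ.integrable hf
    calc ∫ x, g x • (Lp.fourierTransformₗᵢ ℝ ℂ (hf2.toLp f)) x
        = ∫ x, ψ x • (𝓕 (hf2.toLp f)) x := by
          refine integral_congr_ae (Eventually.of_forall fun x => ?_)
          simp only [hψ', Complex.real_smul, smul_eq_mul]
          rfl
      _ = ∫ x, 𝓕 ψ x * f x := by
          rw [← h1]
          refine integral_congr_ae ?_
          filter_upwards [hf2.coeFn_toLp] with x hx
          rw [hx, smul_eq_mul]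
      _ = ∫ x, g x • 𝓕 f x := by
          rw [SchwartzMap.fourier_coe, h2]
          simp [hψ']

/-- On `L¹ ∩ L²` the inverse `L²` Fourier transform is given by the inverse Fourier integral. -/
theorem fourier_symm_toLp_eq {f g : ℝ → ℂ} (hf : Integrable f) (hf2 : MemLp f 2) (hg : MemLp g 2)
    (h : ∀ x, 𝓕⁻ f x = g x) :
    (Lp.fourierTransformₗᵢ ℝ ℂ).symm (hf2.toLp f) = hg.toLp g := by
  apply Lp.ext
  refine EventuallyEq.trans ?_ hg.coeFn_toLp.symm
  apply ae_eq_of_integral_contDiff_smul_eq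
  · exact (Lp.memLp _).locallyIntegrable (by norm_num)
  · exact hg.locallyIntegrable (by norm_num)
  · intro u u_smooth u_cpt
    have hu₁ : HasCompactSupport (Complex.ofRealCLM ∘ u) := u_cpt.comp_left rfl
    have hu₂ : ContDiff ℝ (⊤ : ℕ∞) (Complex.ofRealCLM ∘ u) := by fun_prop
    set ψ := hu₁.toSchwartzMap hu₂ with hψ
    have hψ' : ∀ x, ψ x = (u x : ℂ) := fun x => rfl
    have h1 := congrArg (fun T => T ψ) (Lp.fourierInv_toTemperedDistribution_eq (hf2.toLp f))
    simp only [TemperedDistribution.fourierInv_apply, Lp.toTemperedDistribution_apply] at h1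
    have h2 := integral_fourierInv_mul_eq ψ.integrable hf
    calc ∫ x, u x • ((Lp.fourierTransformₗᵢ ℝ ℂ).symm (hf2.toLp f)) x
        = ∫ x, ψ x • (𝓕⁻ (hf2.toLp f)) x := by
          refine integral_congr_ae (Eventually.of_forall fun x => ?_)
          simp only [hψ', Complex.real_smul, smul_eq_mul]
          rfl
      _ = ∫ x, 𝓕⁻ ψ x * f x := by
          rw [← h1]
          refine integral_congr_ae ?_
          filter_upwards [hf2.coeFn_toLp] with x hx
          rw [hx, smul_eq_mul]
      _ = ∫ x, u x • g x := by
          rw [SchwartzMap.fourierInv_coe, h2]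
          simp [hψ', h]

/-! ### Laplace transforms of powers -/

theorem integrableOn_pow_mul_cexp (k : ℕ) {r : ℂ} (hr : 0 < r.re) :
    IntegrableOn (fun t : ℝ => (t : ℂ) ^ k * Complex.exp (-r * t)) (Ioi 0) := by
  have h := integrableOn_rpow_mul_exp_neg_mul_rpow (s := k) (p := 1) (b := r.re)
    (by have := k.cast_nonneg (α := ℝ); linarith) (by norm_num) hr
  refine (integrable_norm_iff ?_).mp ?_
  · exact Continuous.aestronglyMeasurable (by fun_prop)
  · refine h.congr ?_
    filter_upwards [ae_restrict_mem measurableSet_Ioi] with t ht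
    have ht' : 0 < t := ht
    simp [Complex.norm_exp, abs_of_pos ht']

theorem integral_pow_mul_cexp (k : ℕ) {r : ℂ} (hr : 0 < r.re) :
    ∫ t : ℝ in Ioi 0, (t : ℂ) ^ k * Complex.exp (-r * t) = k.factorial / r ^ (k + 1) := by
  have hr0 : r ≠ 0 := by rintro rfl; simp at hr
  induction k with
  | zero =>
    simp only [pow_zero, one_mul]
    rw [integral_exp_mul_complex_Ioi (by simpa using hr)]
    simp
  | succ k ih =>
    have hd : ∀ t ∈ Ici (0 : ℝ), HasDerivAt
        (fun t : ℝ => (t : ℂ) ^ (k + 1) * Complex.exp (-r * t))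
        ((k + 1 : ℂ) * ((t : ℂ) ^ k * Complex.exp (-r * t)) -
          r * ((t : ℂ) ^ (k + 1) * Complex.exp (-r * t))) t := by
      intro t _
      have h1 : HasDerivAt (fun t : ℝ => (t : ℂ)) 1 t := Complex.ofRealCLM.hasDerivAt
      have h2 := (h1.pow (k + 1)).mul ((h1.const_mul (-r)).cexp)
      convert! h2 using 1
      simp only [Pi.pow_apply, Nat.add_sub_cancel]
      push_cast
      ring
    have hi := ((integrableOn_pow_mul_cexp k hr).const_mul (k + 1 : ℂ)).sub
      ((integrableOn_pow_mul_cexp (k + 1) hr).const_mul r)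
    have hlim : Tendsto (fun t : ℝ => (t : ℂ) ^ (k + 1) * Complex.exp (-r * t)) atTop (𝓝 0) := by
      rw [tendsto_zero_iff_norm_tendsto_zero]
      have := tendsto_rpow_mul_exp_neg_mul_atTop_nhds_zero (k + 1 : ℝ) r.re hr
      refine this.congr' ?_
      filter_upwards [eventually_gt_atTop 0] with t ht
      rw [norm_mul, norm_pow, Complex.norm_exp]
      simp only [Complex.norm_real, Real.norm_eq_abs, abs_of_pos ht]
      norm_cast
      simp
    have h := integral_Ioi_of_hasDerivAt_of_tendsto' hd hi hlim
    rw [integral_sub ((integrableOn_pow_mul_cexp k hr).const_mul (k + 1 : ℂ))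
      ((integrableOn_pow_mul_cexp (k + 1) hr).const_mul r), integral_const_mul,
      integral_const_mul, ih] at h
    simp only [Complex.ofReal_zero, ne_eq, Nat.add_eq_zero_iff, one_ne_zero, and_false,
      not_false_eq_true, zero_pow, zero_mul, sub_zero] at h
    rw [sub_eq_zero] at h
    rw [eq_div_iff (by positivity), Nat.factorial_succ]
    push_cast
    rw [mul_div_assoc', eq_comm, eq_div_iff (pow_ne_zero _ hr0)] at h
    linear_combination h

/-! ### The rational orthogonal basis of the Hardy spaces -/

theorem ofReal_add_I_ne_zero (x : ℝ) : (x : ℂ) + Complex.I ≠ 0 := by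
  intro h
  simpa using congrArg Complex.im h

theorem ofReal_sub_I_ne_zero (x : ℝ) : (x : ℂ) - Complex.I ≠ 0 := by
  intro h
  simpa using congrArg Complex.im h

/-- The Cayley transform `x ↦ (x - i) / (x + i)` of the real line onto the unit circle. -/
def cayley (x : ℝ) : ℂ := (x - Complex.I) / (x + Complex.I)

/-- The functions `z ^ n / (x + i)`, where `z` is the Cayley transform of `x`. They form an
orthogonal system in `L²(ℝ)`, with `n ≥ 0` in the Hardy space of the upper half-plane and `n < 0`
in that of the lower one. -/
def hardyFn (n : ℤ) (x : ℝ) : ℂ := cayley x ^ n / (x + Complex.I)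

theorem cayley_ne_zero (x : ℝ) : cayley x ≠ 0 :=
  div_ne_zero (ofReal_sub_I_ne_zero x) (ofReal_add_I_ne_zero x)

theorem conj_add_I (x : ℝ) : (starRingEnd ℂ) (x + Complex.I) = x - Complex.I := by
  simp [sub_eq_add_neg]

theorem conj_sub_I (x : ℝ) : (starRingEnd ℂ) (x - Complex.I) = x + Complex.I := by
  simp

theorem conj_cayley (x : ℝ) : (starRingEnd ℂ) (cayley x) = (cayley x)⁻¹ := by
  rw [cayley, map_div₀, conj_add_I, conj_sub_I, inv_div]

theorem norm_cayley (x : ℝ) : ‖cayley x‖ = 1 := by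
  have h := Complex.mul_conj (cayley x)
  rw [conj_cayley, mul_inv_cancel₀ (cayley_ne_zero x), Complex.normSq_eq_norm_sq] at h
  have h' : ‖cayley x‖ ^ 2 = 1 := by exact_mod_cast h.symm
  exact (pow_eq_one_iff_of_nonneg (norm_nonneg _) two_ne_zero).1 h'

theorem cayley_neg (x : ℝ) : cayley (-x) = (cayley x)⁻¹ := by
  have h := ofReal_add_I_ne_zero x
  have h' := ofReal_sub_I_ne_zero x
  rw [cayley, cayley, inv_div, Complex.ofReal_neg,
    show -(x : ℂ) - Complex.I = -(x + Complex.I) by ring,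
    show -(x : ℂ) + Complex.I = -(x - Complex.I) by ring, neg_div_neg_eq]

theorem continuous_cayley : Continuous cayley := by
  unfold cayley
  exact Continuous.div (by fun_prop) (by fun_prop) ofReal_add_I_ne_zero

theorem hardyFn_neg (n : ℤ) (x : ℝ) : hardyFn n (-x) = -hardyFn (-n - 1) x := by
  have h := ofReal_add_I_ne_zero x
  have h' := ofReal_sub_I_ne_zero x
  rw [hardyFn, hardyFn, cayley_neg, inv_zpow', zpow_sub_one₀ (cayley_ne_zero x), cayley, inv_div,
    Complex.ofReal_neg, show -(x : ℂ) + Complex.I = -(x - Complex.I) by ring]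
  field_simp

theorem sq_add_one_eq (x : ℝ) :
    ((x : ℂ) + Complex.I) * (x - Complex.I) = ((x ^ 2 + 1 : ℝ) : ℂ) := by
  push_cast
  linear_combination -Complex.I_sq

theorem norm_add_I_sq (x : ℝ) : ‖(x : ℂ) + Complex.I‖ ^ 2 = x ^ 2 + 1 := by
  rw [← Complex.normSq_eq_norm_sq, Complex.normSq_apply]
  simp
  ring

theorem norm_hardyFn_sq (n : ℤ) (x : ℝ) : ‖hardyFn n x‖ ^ 2 = (1 + x ^ 2)⁻¹ := by
  rw [hardyFn, norm_div, norm_zpow, norm_cayley, one_zpow, div_pow, norm_add_I_sq, one_pow,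
    one_div, add_comm]

theorem continuous_hardyFn (n : ℤ) : Continuous (hardyFn n) := by
  unfold hardyFn
  exact (continuous_cayley.zpow₀ n fun x => Or.inl (cayley_ne_zero x)).div (by fun_prop)
    ofReal_add_I_ne_zero

theorem memLp_hardyFn (n : ℤ) : MemLp (hardyFn n) 2 := by
  rw [memLp_two_iff_integrable_sq_norm (continuous_hardyFn n).aestronglyMeasurable]
  simp only [norm_hardyFn_sq]
  exact integrable_inv_one_add_sq

theorem hardyFn_mul_conj (n m : ℤ) (x : ℝ) :
    hardyFn n x * (starRingEnd ℂ) (hardyFn m x) = cayley x ^ (n - m) * phi x := by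
  have h := cayley_ne_zero x
  rw [hardyFn, hardyFn, map_div₀, map_zpow₀, conj_cayley, conj_add_I, div_mul_div_comm,
    sq_add_one_eq, inv_zpow', ← zpow_add₀ h, phi, div_eq_mul_inv, sub_eq_add_neg,
    Complex.ofReal_inv]

/-! ### The Hilbert transform on the rational basis -/

/-- `f` is an `L²` function which the Hilbert transform multiplies by `-i`. -/
def IsHardyPlus (f : ℝ → ℂ) : Prop :=
  ∃ hf : MemLp f 2 volume, hilbertCLM (hf.toLp f) = -Complex.I • hf.toLp f

theorem IsHardyPlus.add {f g : ℝ → ℂ} (hf : IsHardyPlus f) (hg : IsHardyPlus g) :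
    IsHardyPlus (f + g) := by
  obtain ⟨hf, hf'⟩ := hf
  obtain ⟨hg, hg'⟩ := hg
  exact ⟨hf.add hg, by rw [MemLp.toLp_add hf hg, map_add, hf', hg', smul_add]⟩

theorem IsHardyPlus.const_smul {f : ℝ → ℂ} (hf : IsHardyPlus f) (c : ℂ) :
    IsHardyPlus (c • f) := by
  obtain ⟨hf, hf'⟩ := hf
  exact ⟨hf.const_smul c, by rw [MemLp.toLp_const_smul c hf, map_smul, hf', smul_comm]⟩

/-- The function `ξ ^ k e^{-2πξ}` on `(0, ∞)`, extended by zero. -/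
def laguerreFn (k : ℕ) : ℝ → ℂ :=
  (Ioi 0).indicator fun t => (t : ℂ) ^ k * Complex.exp (-(2 * Real.pi : ℂ) * t)

theorem integrable_laguerreFn (k : ℕ) : Integrable (laguerreFn k) := by
  rw [laguerreFn, integrable_indicator_iff measurableSet_Ioi]
  exact integrableOn_pow_mul_cexp k (by simp [Real.pi_pos])

theorem memLp_laguerreFn (k : ℕ) : MemLp (laguerreFn k) 2 := by
  rw [memLp_two_iff_integrable_sq_norm (integrable_laguerreFn k).aestronglyMeasurable]
  have h : IntegrableOn (fun t : ℝ => ‖(t : ℂ) ^ (2 * k) * Complex.exp (-(4 * Real.pi : ℂ) * t)‖)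
      (Ioi 0) :=
    (integrableOn_pow_mul_cexp (2 * k) (by simp [Real.pi_pos])).norm
  rw [← integrable_indicator_iff measurableSet_Ioi] at h
  refine h.congr (Eventually.of_forall fun t => ?_)
  by_cases ht : t ∈ Ioi (0 : ℝ)
  · simp only [laguerreFn, indicator_of_mem ht]
    rw [← norm_pow, mul_pow, ← pow_mul, ← Complex.exp_nat_mul, mul_comm k 2]
    congr 3
    push_cast
    ring
  · simp [laguerreFn, indicator_of_notMem ht]

theorem fourierInv_laguerreFn (k : ℕ) (x : ℝ) :
    𝓕⁻ (laguerreFn k) x =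
      k.factorial / (-(2 * Real.pi * Complex.I)) ^ (k + 1) * ((x + Complex.I) ^ (k + 1))⁻¹ := by
  have hr : 0 < (-(2 * Real.pi * Complex.I) * (x + Complex.I)).re := by
    simp [Real.pi_pos]
  have h := integral_pow_mul_cexp k hr
  rw [mul_pow] at h
  rw [Real.fourierInv_eq', div_mul_eq_mul_div, ← div_eq_mul_inv, div_div,
    mul_comm _ ((-(2 * Real.pi * Complex.I)) ^ (k + 1)), ← h,
    ← integral_indicator measurableSet_Ioi]
  refine integral_congr_ae (Eventually.of_forall fun t => ?_)
  by_cases ht : t ∈ Ioi (0 : ℝ)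
  · simp only [laguerreFn, indicator_of_mem ht, smul_eq_mul]
    rw [mul_left_comm, ← Complex.exp_add]
    congr 2
    simp
    linear_combination (-2 * Real.pi * t : ℂ) * Complex.I_sq
  · simp [laguerreFn, indicator_of_notMem ht]

theorem norm_add_I_ge (x : ℝ) : 1 ≤ ‖(x : ℂ) + Complex.I‖ := by
  have := norm_add_I_sq x
  nlinarith [norm_nonneg ((x : ℂ) + Complex.I), sq_nonneg x]

theorem memLp_inv_pow (k : ℕ) : MemLp (fun x : ℝ => (((x : ℂ) + Complex.I) ^ (k + 1))⁻¹) 2 := by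
  refine (memLp_hardyFn 0).of_le ?_ (Eventually.of_forall fun x => ?_)
  · exact (Continuous.inv₀ (by fun_prop)
      fun x => pow_ne_zero _ (ofReal_add_I_ne_zero x)).aestronglyMeasurable
  · have h := norm_add_I_ge x
    rw [hardyFn, zpow_zero, norm_div, norm_one, norm_inv, norm_pow, one_div]
    gcongr
    exact le_self_pow₀ h (by omega)

/-- Functions whose Fourier transform lives on `(0, ∞)` are multiplied by `-i`. -/
theorem hilbertCLM_of_fourier {f : L2} {g : ℝ → ℂ} (h : Lp.fourierTransformₗᵢ ℝ ℂ f =ᵐ[volume] g)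
    (hg : ∀ ξ ≤ 0, g ξ = 0) : hilbertCLM f = -Complex.I • f := by
  apply (Lp.fourierTransformₗᵢ ℝ ℂ).injective
  rw [map_smul]
  apply Lp.ext
  filter_upwards [fourier_hilbertCLM f, h,
    Lp.coeFn_smul (-Complex.I) (Lp.fourierTransformₗᵢ ℝ ℂ f)] with ξ h1 h2 h3
  rw [h1, h3, Pi.smul_apply, smul_eq_mul, h2]
  rcases le_or_gt ξ 0 with hξ | hξ
  · simp [hg ξ hξ]
  · simp [hξ]

theorem isHardyPlus_inv_pow (k : ℕ) :
    IsHardyPlus (fun x : ℝ => (((x : ℂ) + Complex.I) ^ (k + 1))⁻¹) := by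
  set c : ℂ := k.factorial / (-(2 * Real.pi * Complex.I)) ^ (k + 1) with hc
  have hc0 : c ≠ 0 := by
    refine div_ne_zero (by exact_mod_cast k.factorial_ne_zero) (pow_ne_zero _ ?_)
    simp [Real.pi_ne_zero]
  have h : IsHardyPlus (c • fun x : ℝ => (((x : ℂ) + Complex.I) ^ (k + 1))⁻¹) := by
    refine ⟨(memLp_inv_pow k).const_smul c, ?_⟩
    rw [← fourier_symm_toLp_eq (integrable_laguerreFn k) (memLp_laguerreFn k)
      ((memLp_inv_pow k).const_smul c) (fun x => fourierInv_laguerreFn k x)]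
    refine hilbertCLM_of_fourier (g := laguerreFn k) ?_ ?_
    · rw [LinearIsometryEquiv.apply_symm_apply]
      exact (memLp_laguerreFn k).coeFn_toLp
    · intro ξ hξ
      exact indicator_of_notMem (by simpa using hξ) _
  simpa [smul_smul, inv_mul_cancel₀ hc0] using h.const_smul c⁻¹

theorem cayley_eq (x : ℝ) : cayley x = 1 - 2 * Complex.I * (x + Complex.I)⁻¹ := by
  have h := ofReal_add_I_ne_zero x
  rw [cayley]
  field_simp
  ring

theorem isHardyPlus_cayley_pow (n k : ℕ) :
    IsHardyPlus (fun x : ℝ => cayley x ^ n * (((x : ℂ) + Complex.I) ^ (k + 1))⁻¹) := by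
  induction n generalizing k with
  | zero => simpa using isHardyPlus_inv_pow k
  | succ n ih =>
    convert! (ih k).add ((ih (k + 1)).const_smul (-2 * Complex.I)) using 1
    ext x
    simp only [Pi.add_apply, Pi.smul_apply, smul_eq_mul]
    rw [pow_succ, pow_succ _ (k + 1), cayley_eq, mul_inv]
    ring

/-- The `n`-th function of the rational basis as an element of `L²(ℝ)`. -/
def hardyLp (n : ℤ) : L2 := (memLp_hardyFn n).toLp _

theorem coeFn_hardyLp (n : ℤ) : hardyLp n =ᵐ[volume] hardyFn n := (memLp_hardyFn n).coeFn_toLp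

theorem hilbertCLM_hardyLp_natCast (n : ℕ) : hilbertCLM (hardyLp n) = -Complex.I • hardyLp n := by
  obtain ⟨hf, h⟩ := isHardyPlus_cayley_pow n 0
  have e : hardyLp n = hf.toLp _ := by
    refine MemLp.toLp_congr _ _ (Eventually.of_forall fun x => ?_)
    simp [hardyFn, div_eq_mul_inv]
  rw [e, h]

theorem reflect_hardyLp (n : ℤ) : reflect (hardyLp n) = -hardyLp (-n - 1) := by
  apply Lp.ext
  have q := (Measure.measurePreserving_neg (volume : Measure ℝ)).quasiMeasurePreserving
  filter_upwards [coeFn_reflect (hardyLp n), q.ae (coeFn_hardyLp n), coeFn_hardyLp (-n - 1),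
    Lp.coeFn_neg (hardyLp (-n - 1))] with x h1 h2 h3 h4
  rw [h1, h2, h4, Pi.neg_apply, h3, hardyFn_neg]

theorem hilbertCLM_hardyLp_neg (n : ℕ) :
    hilbertCLM (hardyLp (-n - 1)) = Complex.I • hardyLp (-n - 1) := by
  have h := reflect_hilbertCLM (hardyLp n)
  rw [hilbertCLM_hardyLp_natCast, map_smul, reflect_hardyLp, map_neg, neg_neg] at h
  rw [← h, smul_neg, neg_smul, neg_neg]

/-! ### Operators intertwined with multiplication by `φ` -/

section Intertwining

variable {E : Type*} [NormedAddCommGroup E] [InnerProductSpace ℂ E]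
  {J : E →L[ℂ] L2} {S : E →L[ℂ] E}

/-- The real-valued version of `φ`. -/
def phiReal (x : ℝ) : ℝ := (x ^ 2 + 1)⁻¹

theorem phi_eq (x : ℝ) : phi x = (phiReal x : ℂ) := rfl

theorem phiReal_mem_Icc (x : ℝ) : phiReal x ∈ Icc (0 : ℝ) 1 :=
  ⟨by unfold phiReal; positivity, inv_le_one_of_one_le₀ (by nlinarith [sq_nonneg x])⟩

theorem inner_mulOp_phi_symm (f g : L2) :
    inner ℂ (mulOp phi memLp_phi f) g = inner ℂ f (mulOp phi memLp_phi g) := by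
  rw [L2.inner_def, L2.inner_def]
  refine integral_congr_ae ?_
  filter_upwards [coeFn_mulOp phi memLp_phi f, coeFn_mulOp phi memLp_phi g] with x h1 h2
  rw [h1, h2, RCLike.inner_apply, RCLike.inner_apply, phi_eq, map_mul, Complex.conj_ofReal]
  ring

theorem integrable_phiReal_mul_norm_sq (f : L2) :
    Integrable fun x => phiReal x * ‖f x‖ ^ 2 := by
  have hf := (memLp_two_iff_integrable_sq_norm (Lp.aestronglyMeasurable f)).1 (Lp.memLp f)
  refine hf.bdd_mul (c := 1) ?_ (Eventually.of_forall fun x => ?_)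
  · exact (Continuous.inv₀ (by fun_prop) (fun x => by positivity)).aestronglyMeasurable
  · rw [Real.norm_of_nonneg (phiReal_mem_Icc x).1]
    exact (phiReal_mem_Icc x).2

theorem re_inner_mulOp_phi (f : L2) :
    RCLike.re (inner ℂ (mulOp phi memLp_phi f) f) = ∫ x, phiReal x * ‖f x‖ ^ 2 := by
  have h : inner ℂ (mulOp phi memLp_phi f) f = ((∫ x, phiReal x * ‖f x‖ ^ 2 : ℝ) : ℂ) := by
    rw [← integral_complex_ofReal, L2.inner_def]
    refine integral_congr_ae ?_
    filter_upwards [coeFn_mulOp phi memLp_phi f] with x h1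
    rw [h1, RCLike.inner_apply, phi_eq, map_mul, Complex.conj_ofReal]
    have := Complex.mul_conj' (f x)
    push_cast
    linear_combination (phiReal x : ℂ) * this
  rw [h]
  exact Complex.ofReal_re _

theorem norm_sq_eq_integral (f : L2) : ‖f‖ ^ 2 = ∫ x, ‖f x‖ ^ 2 := by
  have h : inner ℂ f f = ((∫ x, ‖f x‖ ^ 2 : ℝ) : ℂ) := by
    rw [← integral_complex_ofReal, L2.inner_def]
    refine integral_congr_ae (Eventually.of_forall fun x => ?_)
    simp
  rw [inner_self_eq_norm_sq_to_K] at h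
  exact Complex.ofReal_injective (by simpa using h)

theorem re_inner_mulOp_phi_le (f : L2) :
    RCLike.re (inner ℂ (mulOp phi memLp_phi f) f) ≤ ‖f‖ ^ 2 := by
  rw [re_inner_mulOp_phi, norm_sq_eq_integral]
  refine integral_mono (integrable_phiReal_mul_norm_sq f)
    ((memLp_two_iff_integrable_sq_norm (Lp.aestronglyMeasurable f)).1 (Lp.memLp f)) fun x => ?_
  exact mul_le_of_le_one_left (by positivity) (phiReal_mem_Icc x).2

theorem isSymmetric_of_intertwine (hJ : ∀ u v, inner ℂ (J u) (J v) = inner ℂ u v)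
    (hS : ∀ u, J (S u) = mulOp phi memLp_phi (J u)) : (S : E →ₗ[ℂ] E).IsSymmetric := by
  intro u v
  change inner ℂ (S u) v = inner ℂ u (S v)
  rw [← hJ, ← hJ, hS, hS, inner_mulOp_phi_symm]

theorem intertwine_aeval (hS : ∀ u, J (S u) = mulOp phi memLp_phi (J u)) (P : Polynomial ℝ)
    (u : E) :
    J (Polynomial.aeval S P u) =ᵐ[volume] fun x => ((P.eval (phiReal x) : ℝ) : ℂ) * J u x := by
  induction P using Polynomial.induction_on' generalizing u with
  | add p q hp hq =>
    rw [map_add, add_apply, map_add]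
    filter_upwards [hp u, hq u, Lp.coeFn_add (J (Polynomial.aeval S p u))
      (J (Polynomial.aeval S q u))] with x h1 h2 h3
    rw [h3, Pi.add_apply, h1, h2, Polynomial.eval_add]
    push_cast
    ring
  | monomial n a =>
    rw [Polynomial.aeval_monomial]
    have h : ∀ (k : ℕ) (u : E),
        J ((S ^ k) u) =ᵐ[volume] fun x => ((phiReal x) ^ k : ℂ) * J u x := by
      intro k
      induction k with
      | zero => intro u; simp
      | succ k ih =>
        intro u
        rw [pow_succ, mul_apply_eq_comp]
        have h1 := ih (S u)
        rw [hS] at h1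
        filter_upwards [h1, coeFn_mulOp phi memLp_phi (J u)] with x h1 h2
        rw [h1, h2, phi_eq]
        ring
    have e : (algebraMap ℝ (E →L[ℂ] E) a * S ^ n) u = (a : ℂ) • (S ^ n) u := by
      rw [Algebra.algebraMap_eq_smul_one, smul_mul_assoc, one_mul, smul_apply]
      exact RCLike.real_smul_eq_coe_smul a _
    rw [e, map_smul]
    filter_upwards [h n u, Lp.coeFn_smul (a : ℂ) (J ((S ^ n) u))] with x h1 h2
    rw [h2, Pi.smul_apply, h1, Polynomial.eval_monomial, smul_eq_mul]
    push_cast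
    ring

variable [CompleteSpace E]

theorem isSelfAdjoint_of_intertwine (hJ : ∀ u v, inner ℂ (J u) (J v) = inner ℂ u v)
    (hS : ∀ u, J (S u) = mulOp phi memLp_phi (J u)) : IsSelfAdjoint S :=
  ContinuousLinearMap.isSelfAdjoint_iff_isSymmetric.2 (isSymmetric_of_intertwine hJ hS)

theorem spectrum_subset_of_intertwine (hJ : ∀ u v, inner ℂ (J u) (J v) = inner ℂ u v)
    (hS : ∀ u, J (S u) = mulOp phi memLp_phi (J u)) : spectrum ℝ S ⊆ Icc 0 1 := by
  have hsa := isSelfAdjoint_of_intertwine hJ hS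
  have hsym := isSymmetric_of_intertwine hJ hS
  have h0 : (0 : E →L[ℂ] E) ≤ S := by
    rw [ContinuousLinearMap.nonneg_iff_isPositive]
    refine ⟨hsym, fun u => ?_⟩
    rw [ContinuousLinearMap.reApplyInnerSelf_apply, ← hJ, hS, re_inner_mulOp_phi]
    exact integral_nonneg fun x => mul_nonneg (phiReal_mem_Icc x).1 (by positivity)
  have h1 : S ≤ algebraMap ℝ (E →L[ℂ] E) 1 := by
    rw [map_one, ContinuousLinearMap.le_def]
    refine ⟨LinearMap.IsSymmetric.sub (fun u v => rfl) hsym, fun u => ?_⟩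
    rw [ContinuousLinearMap.reApplyInnerSelf_apply, sub_apply, inner_sub_left,
      map_sub, ← hJ (S u), hS, one_apply_eq_self, inner_self_eq_norm_sq]
    have h := re_inner_mulOp_phi_le (J u)
    have hn : ‖J u‖ ^ 2 = ‖u‖ ^ 2 := by
      rw [← inner_self_eq_norm_sq (𝕜 := ℂ), ← inner_self_eq_norm_sq (𝕜 := ℂ), hJ]
    linarith
  intro x hx
  exact ⟨spectrum_nonneg_of_nonneg h0 hx, (le_algebraMap_iff_spectrum_le hsa).1 h1 x hx⟩

/-- Matrix elements of `h(S)` are limits of those of `P_K(S)` when the polynomials `P_K` converge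
to `h` uniformly on `[0, 1]`. -/
theorem tendsto_inner_aeval (hJ : ∀ u v, inner ℂ (J u) (J v) = inner ℂ u v)
    (hS : ∀ u, J (S u) = mulOp phi memLp_phi (J u)) {h : ℝ → ℝ} (hc : Continuous h)
    {P : ℕ → Polynomial ℝ} {δ : ℕ → ℝ} (hδ : Tendsto δ atTop (𝓝 0))
    (hP : ∀ K, ∀ s ∈ Icc (0 : ℝ) 1, |h s - (P K).eval s| ≤ δ K) (u v : E) :
    Tendsto (fun K => inner ℂ v (Polynomial.aeval S (P K) u)) atTop
      (𝓝 (inner ℂ v (opFun h S u))) := by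
  have hsa := isSelfAdjoint_of_intertwine hJ hS
  have hspec := spectrum_subset_of_intertwine hJ hS
  have hlim : Tendsto (fun K => Polynomial.aeval S (P K)) atTop (𝓝 (opFun h S)) := by
    rw [tendsto_iff_norm_sub_tendsto_zero]
    refine squeeze_zero (fun _ => norm_nonneg _) (fun K => ?_) hδ
    have hδK : 0 ≤ δ K := (abs_nonneg _).trans (hP K 0 (by simp))
    rw [norm_sub_rev, opFun, ← cfc_polynomial (P K) S hsa,
      ← cfc_sub h (fun x => (P K).eval x) S hc.continuousOn (P K).continuous.continuousOn]
    exact norm_cfc_le hδK fun s hs => by simpa using hP K s (hspec hs)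
  have h2 : Tendsto (fun K => Polynomial.aeval S (P K) u) atTop (𝓝 (opFun h S u)) :=
    ((ContinuousLinearMap.apply ℂ E u).continuous.tendsto _).comp hlim
  exact tendsto_const_nhds.inner h2

end Intertwining

/-! ### The two operators on the even functions -/

theorem inner_hilbertCLM (f g : L2) : inner ℂ (hilbertCLM f) (hilbertCLM g) = inner ℂ f g := by
  rw [← (Lp.fourierTransformₗᵢ ℝ ℂ).inner_map_map (hilbertCLM f),
    ← (Lp.fourierTransformₗᵢ ℝ ℂ).inner_map_map f, L2.inner_def, L2.inner_def]
  refine integral_congr_ae ?_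
  have h0 : ∀ᵐ ξ : ℝ, ξ ≠ 0 := by simp [ae_iff]
  filter_upwards [fourier_hilbertCLM f, fourier_hilbertCLM g, h0] with ξ h1 h2 h3
  rw [h1, h2, RCLike.inner_apply, RCLike.inner_apply, map_mul, map_mul, map_neg, Complex.conj_I]
  rcases lt_or_gt_of_ne h3 with hξ | hξ
  · simp [hξ]
    linear_combination (-(Lp.fourierTransformₗᵢ ℝ ℂ g ξ) *
      (starRingEnd ℂ) (Lp.fourierTransformₗᵢ ℝ ℂ f ξ)) * Complex.I_sq
  · simp [hξ]
    linear_combination (-(Lp.fourierTransformₗᵢ ℝ ℂ g ξ) *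
      (starRingEnd ℂ) (Lp.fourierTransformₗᵢ ℝ ℂ f ξ)) * Complex.I_sq

/-- The Hilbert transform restricted to the even functions, which intertwines `A` with `M_φ`. -/
def hilbertEven : evenL2 →L[ℂ] L2 := hilbertCLM ∘L evenL2.subtypeL

theorem inner_hilbertEven (u v : evenL2) :
    inner ℂ (hilbertEven u) (hilbertEven v) = inner ℂ u v :=
  inner_hilbertCLM _ _

theorem coe_opA (u : evenL2) :
    (opA u : L2) = -hilbertCLM (mulOp phi memLp_phi (hilbertCLM u)) := rfl

theorem hilbertEven_opA (u : evenL2) :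
    hilbertEven (opA u) = mulOp phi memLp_phi (hilbertEven u) := by
  change hilbertCLM (opA u : L2) = _
  rw [coe_opA, map_neg, hilbertCLM_hilbertCLM, neg_neg]
  rfl

theorem inner_subtypeL (u v : evenL2) :
    inner ℂ (evenL2.subtypeL u) (evenL2.subtypeL v) = inner ℂ u v := rfl

theorem subtypeL_opB (u : evenL2) :
    evenL2.subtypeL (opB u) = mulOp phi memLp_phi (evenL2.subtypeL u) := rfl

theorem isSelfAdjoint_opA : IsSelfAdjoint opA :=
  isSelfAdjoint_of_intertwine inner_hilbertEven hilbertEven_opA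

theorem isSelfAdjoint_opB : IsSelfAdjoint opB :=
  isSelfAdjoint_of_intertwine inner_subtypeL subtypeL_opB

/-! ### The Hankel structure of `h(A) - h(B)` -/

theorem tendsto_cayley {l : Filter ℝ} (hl : Tendsto (fun x : ℝ => ‖(x : ℂ) + Complex.I‖) l atTop) :
    Tendsto cayley l (𝓝 1) := by
  have h : Tendsto (fun x : ℝ => ((x : ℂ) + Complex.I)⁻¹) l (𝓝 0) := by
    rw [tendsto_zero_iff_norm_tendsto_zero]
    exact hl.inv_tendsto_atTop.congr fun x => by simp
  have h2 := (h.const_mul (2 * Complex.I)).const_sub 1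
  rw [mul_zero, sub_zero] at h2
  exact h2.congr fun x => (cayley_eq x).symm

theorem abs_le_norm_add_I (x : ℝ) : |x| ≤ ‖(x : ℂ) + Complex.I‖ := by
  simpa using Complex.abs_re_le_norm ((x : ℂ) + Complex.I)

theorem tendsto_cayley_atTop : Tendsto cayley atTop (𝓝 1) :=
  tendsto_cayley (tendsto_atTop_mono abs_le_norm_add_I tendsto_abs_atTop_atTop)

theorem tendsto_cayley_atBot : Tendsto cayley atBot (𝓝 1) :=
  tendsto_cayley (tendsto_atTop_mono abs_le_norm_add_I tendsto_abs_atBot_atTop)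

theorem hasDerivAt_cayley (x : ℝ) :
    HasDerivAt cayley (2 * Complex.I * cayley x * phi x) x := by
  have h0 : HasDerivAt (fun t : ℝ => (t : ℂ)) 1 x := Complex.ofRealCLM.hasDerivAt
  have h := ofReal_add_I_ne_zero x
  have h' := ofReal_sub_I_ne_zero x
  have h1 := (h0.sub_const Complex.I).div (h0.add_const Complex.I) h
  convert! h1 using 1
  rw [phi, Complex.ofReal_inv, ← sq_add_one_eq, cayley]
  field_simp
  ring

theorem continuous_phi : Continuous phi := by
  unfold phi
  exact Complex.continuous_ofReal.comp (Continuous.inv₀ (by fun_prop) (fun x => by positivity))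

theorem continuous_cayley_zpow (k : ℤ) : Continuous fun x => cayley x ^ k :=
  continuous_cayley.zpow₀ k fun x => Or.inl (cayley_ne_zero x)

theorem integrable_phi : Integrable phi := by
  have h := integrable_inv_one_add_sq.ofReal (𝕜 := ℂ)
  refine h.congr (Eventually.of_forall fun x => ?_)
  simp [phi, add_comm]

theorem integrable_cayley_zpow_mul_phi (k : ℤ) : Integrable fun x => cayley x ^ k * phi x := by
  refine integrable_phi.bdd_mul (c := 1) (continuous_cayley_zpow k).aestronglyMeasurable
    (Eventually.of_forall fun x => ?_)
  rw [norm_zpow, norm_cayley, one_zpow]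

/-- The powers of the Cayley transform are orthogonal with respect to `dx / (x² + 1)`. -/
theorem integral_cayley_zpow_mul_phi (k : ℤ) :
    ∫ x, cayley x ^ k * phi x = if k = 0 then (Real.pi : ℂ) else 0 := by
  split_ifs with hk
  · subst hk
    have h : ∫ x, cayley x ^ (0 : ℤ) * phi x = ((∫ x : ℝ, (1 + x ^ 2)⁻¹ : ℝ) : ℂ) := by
      rw [← integral_complex_ofReal]
      refine integral_congr_ae (Eventually.of_forall fun x => ?_)
      simp [phi, add_comm]
    rw [h, integral_univ_inv_one_add_sq]
  · have hd : ∀ x, HasDerivAt (fun x => cayley x ^ k)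
        ((2 * Complex.I * k) * (cayley x ^ k * phi x)) x := by
      intro x
      have h := (hasDerivAt_zpow k (cayley x) (Or.inl (cayley_ne_zero x))).comp x
        (hasDerivAt_cayley x)
      convert! h using 1
      rw [zpow_sub_one₀ (cayley_ne_zero x)]
      have := cayley_ne_zero x
      field_simp
    have hlim : ∀ {l : Filter ℝ}, Tendsto cayley l (𝓝 1) →
        Tendsto (fun x => cayley x ^ k) l (𝓝 1) := by
      intro l hl
      simpa using hl.zpow₀ k (Or.inl one_ne_zero)
    have h := integral_of_hasDerivAt_of_tendsto hd
      ((integrable_cayley_zpow_mul_phi k).const_mul _) (hlim tendsto_cayley_atBot)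
      (hlim tendsto_cayley_atTop)
    rw [integral_const_mul, sub_self] at h
    refine (mul_eq_zero.1 h).resolve_left ?_
    simpa using hk

theorem inner_hardyLp (n m : ℤ) :
    inner ℂ (hardyLp m) (hardyLp n) = if n = m then (Real.pi : ℂ) else 0 := by
  have h : inner ℂ (hardyLp m) (hardyLp n) = ∫ x, cayley x ^ (n - m) * phi x := by
    rw [L2.inner_def]
    refine integral_congr_ae ?_
    filter_upwards [coeFn_hardyLp n, coeFn_hardyLp m] with x h1 h2
    rw [h1, h2, RCLike.inner_apply, hardyFn_mul_conj]
  rw [h, integral_cayley_zpow_mul_phi]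
  simp only [sub_eq_zero]

/-- The even function `z ^ n / (x + i) - z ^ (-n-1) / (x + i)`, `n ≥ 0`. -/
def evenFn (n : ℕ) : evenL2 :=
  ⟨hardyLp n - hardyLp (-n - 1), by
    rw [mem_evenL2_iff, map_sub, reflect_hardyLp, reflect_hardyLp]
    rw [show -(-(n : ℤ) - 1) - 1 = n by ring]
    abel⟩

theorem coe_evenFn (n : ℕ) : (evenFn n : L2) = hardyLp n - hardyLp (-n - 1) := rfl

theorem inner_evenFn (n m : ℕ) :
    inner ℂ (evenFn m) (evenFn n) = if n = m then (2 * Real.pi : ℂ) else 0 := by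
  rw [Submodule.coe_inner, coe_evenFn, coe_evenFn, inner_sub_left, inner_sub_right,
    inner_sub_right, inner_hardyLp, inner_hardyLp, inner_hardyLp, inner_hardyLp,
    if_neg (by omega : ¬ (-(n : ℤ) - 1 = m)), if_neg (by omega : ¬ ((n : ℤ) = -m - 1))]
  by_cases h : n = m
  · subst h; simp; ring
  · rw [if_neg (by omega), if_neg (by omega), if_neg h]; simp

theorem hilbertEven_evenFn (n : ℕ) :
    hilbertEven (evenFn n) = -Complex.I • (hardyLp n + hardyLp (-n - 1)) := by
  change hilbertCLM (evenFn n : L2) = _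
  rw [coe_evenFn, map_sub, hilbertCLM_hardyLp_natCast, hilbertCLM_hardyLp_neg]
  module

theorem coeFn_evenFn (n : ℕ) :
    (evenFn n : L2) =ᵐ[volume] fun x => hardyFn n x - hardyFn (-n - 1) x := by
  rw [coe_evenFn]
  filter_upwards [Lp.coeFn_sub (hardyLp n) (hardyLp (-n - 1)), coeFn_hardyLp n,
    coeFn_hardyLp (-n - 1)] with x h1 h2 h3
  rw [h1, Pi.sub_apply, h2, h3]

theorem coeFn_hilbertEven_evenFn (n : ℕ) :
    hilbertEven (evenFn n) =ᵐ[volume]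
      fun x => -Complex.I * (hardyFn n x + hardyFn (-n - 1) x) := by
  rw [hilbertEven_evenFn]
  filter_upwards [Lp.coeFn_smul (-Complex.I) (hardyLp n + hardyLp (-n - 1)),
    Lp.coeFn_add (hardyLp n) (hardyLp (-n - 1)), coeFn_hardyLp n,
    coeFn_hardyLp (-n - 1)] with x h1 h2 h3 h4
  rw [h1, Pi.smul_apply, h2, Pi.add_apply, h3, h4, smul_eq_mul]

/-- In the rational basis the operator `P(A) - P(B)` is given by a Hankel matrix: the entry
depends on `n + m` only. -/
theorem inner_aeval_sub (P : Polynomial ℝ) (n m : ℕ) :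
    inner ℂ (evenFn m) (Polynomial.aeval opA P (evenFn n)) -
      inner ℂ (evenFn m) (Polynomial.aeval opB P (evenFn n)) =
    ∫ x, 2 * ((P.eval (phiReal x) : ℝ) : ℂ) *
      (cayley x ^ (n + m + 1 : ℤ) + cayley x ^ (-(n + m + 1) : ℤ)) * phi x := by
  have hA := intertwine_aeval hilbertEven_opA P (evenFn n)
  have hB := intertwine_aeval subtypeL_opB P (evenFn n)
  rw [← inner_hilbertEven, Submodule.coe_inner, L2.inner_def, L2.inner_def,
    ← integral_sub (L2.integrable_inner (𝕜 := ℂ) _ _)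
      (L2.integrable_inner (𝕜 := ℂ) _ _)]
  refine integral_congr_ae ?_
  filter_upwards [hA, hB, coeFn_evenFn n, coeFn_evenFn m, coeFn_hilbertEven_evenFn n,
    coeFn_hilbertEven_evenFn m] with x h1 h2 h3 h4 h5 h6
  have h2' : ((Polynomial.aeval opB P (evenFn n) : evenL2) : L2) x =
      ((P.eval (phiReal x) : ℝ) : ℂ) * (hardyFn n x - hardyFn (-n - 1) x) := by
    rw [← h3]; exact h2
  have h1' : hilbertEven (Polynomial.aeval opA P (evenFn n)) x =
      ((P.eval (phiReal x) : ℝ) : ℂ) * (-Complex.I * (hardyFn n x + hardyFn (-n - 1) x)) := by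
    rw [← h5]; exact h1
  rw [RCLike.inner_apply, RCLike.inner_apply, h1', h2', h4, h6, map_mul, map_neg,
    Complex.conj_I, map_add, map_sub]
  have e1 := hardyFn_mul_conj n (-m - 1) x
  have e2 := hardyFn_mul_conj (-n - 1) m x
  rw [show (n : ℤ) - (-m - 1) = n + m + 1 by ring] at e1
  rw [show -(n : ℤ) - 1 - m = -(n + m + 1) by ring] at e2
  rw [mul_assoc _ (_ + _), add_mul, ← e1, ← e2]
  linear_combination (-((P.eval (phiReal x) : ℝ) : ℂ) * (hardyFn n x + hardyFn (-n - 1) x) *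
    ((starRingEnd ℂ) (hardyFn m x) + (starRingEnd ℂ) (hardyFn (-m - 1) x))) * Complex.I_sq

/-! ### Chebyshev polynomials with a binomial cut-off -/

/-- The polynomial `(1 - y²) ^ M T_N(y)` in the variable `s` with `y = 1 - 2 s`. -/
def cutChebyshev (M N : ℕ) : Polynomial ℝ :=
  ((1 - Polynomial.X ^ 2) ^ M * Polynomial.Chebyshev.T ℝ N).comp (1 - 2 * Polynomial.X)

theorem one_sub_two_mul_phi (x : ℝ) :
    1 - 2 * phi x = (cayley x + (cayley x)⁻¹) / 2 := by
  have h := ofReal_add_I_ne_zero x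
  have h' := ofReal_sub_I_ne_zero x
  rw [phi, Complex.ofReal_inv, ← sq_add_one_eq, cayley, inv_div]
  field_simp
  linear_combination -4 * Complex.I_sq

theorem eval_T_joukowsky {z : ℂ} (hz : z ≠ 0) (N : ℕ) :
    (Polynomial.Chebyshev.T ℂ N).eval ((z + z⁻¹) / 2) = (z ^ (N : ℤ) + z ^ (-N : ℤ)) / 2 := by
  have h := Polynomial.Chebyshev.T_complex_cosh (Complex.log z) N
  rw [Complex.cosh, Complex.exp_neg, Complex.exp_log hz, Complex.cosh] at h
  rw [h, Complex.exp_neg, Int.cast_natCast, Complex.exp_nat_mul, Complex.exp_log hz, zpow_neg,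
    zpow_natCast]

theorem eval_cutChebyshev (M N : ℕ) (x : ℝ) :
    (((cutChebyshev M N).eval (phiReal x) : ℝ) : ℂ) =
      (-1 / 4) ^ M * (cayley x - (cayley x)⁻¹) ^ (2 * M) *
        ((cayley x ^ (N : ℤ) + cayley x ^ (-N : ℤ)) / 2) := by
  have h := cayley_ne_zero x
  rw [cutChebyshev, Polynomial.eval_comp]
  simp only [Polynomial.eval_mul, Polynomial.eval_pow, Polynomial.eval_sub, Polynomial.eval_one,
    Polynomial.eval_X, Polynomial.eval_ofNat]
  push_cast
  rw [← phi_eq, one_sub_two_mul_phi, eval_T_joukowsky h, pow_mul, ← mul_pow]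
  congr 2
  field_simp
  ring

/-- Among the multiples of `2 M + 1` only the zero frequency meets the Fourier support
`[-2 M, 2 M]` of the cut-off. -/
theorem integral_cutoff (M : ℕ) (k : ℤ) :
    ∫ x, (cayley x - (cayley x)⁻¹) ^ (2 * M) * cayley x ^ ((2 * M + 1) * k) * phi x =
      if k = 0 then (-1) ^ M * (M.centralBinom : ℂ) * Real.pi else 0 := by
  have e : ∀ x, (cayley x - (cayley x)⁻¹) ^ (2 * M) * cayley x ^ ((2 * M + 1) * k) * phi x =
      ∑ j ∈ Finset.range (2 * M + 1), (-1) ^ j * ((2 * M).choose j : ℂ) *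
        (cayley x ^ (2 * (M - j : ℤ) + (2 * M + 1) * k) * phi x) := by
    intro x
    have h := cayley_ne_zero x
    rw [sub_eq_neg_add, add_pow, Finset.sum_mul, Finset.sum_mul]
    refine Finset.sum_congr rfl fun j hj => ?_
    have hj' : j ≤ 2 * M := by simpa [Nat.lt_succ_iff] using hj
    rw [show (2 * (M - j : ℤ) + (2 * M + 1) * k) = -(j : ℤ) + ((2 * M - j : ℕ) : ℤ) +
      (2 * M + 1) * k by push_cast [Nat.cast_sub hj']; ring, zpow_add₀ h, zpow_add₀ h, zpow_neg,
      zpow_natCast, zpow_natCast, neg_pow, inv_pow]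
    ring
  simp_rw [e]
  rw [integral_finsetSum _ fun j _ => (integrable_cayley_zpow_mul_phi _).const_mul _]
  simp_rw [integral_const_mul, integral_cayley_zpow_mul_phi]
  split_ifs with hk
  · subst hk
    rw [Finset.sum_eq_single M]
    · simp [Nat.centralBinom]
    · intro j _ hj
      rw [if_neg (by omega), mul_zero]
    · intro h
      simp at h
      omega
  · refine Finset.sum_eq_zero fun j hj => ?_
    have hj' : j ≤ 2 * M := by simpa [Nat.lt_succ_iff] using hj
    rw [if_neg, mul_zero]
    intro h0
    have h1 : |(2 * M + 1 : ℤ) * k| = |2 * (j - M : ℤ)| := by congr 1; linarith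
    have h2 : |2 * (j - M : ℤ)| ≤ 2 * M := by rw [abs_le]; constructor <;> linarith
    have h3 : 1 ≤ |k| := Int.one_le_abs hk
    rw [abs_mul, abs_of_pos (by positivity : (0 : ℤ) < 2 * M + 1)] at h1
    nlinarith

theorem integrable_cutoff (M : ℕ) (k : ℤ) :
    Integrable fun x => (cayley x - (cayley x)⁻¹) ^ (2 * M) * cayley x ^ k * phi x := by
  refine integrable_phi.bdd_mul (c := 2 ^ (2 * M)) ?_ (Eventually.of_forall fun x => ?_)
  · exact (((continuous_cayley.sub (continuous_cayley.inv₀ cayley_ne_zero)).pow _).mul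
      (continuous_cayley_zpow k)).aestronglyMeasurable
  · rw [norm_mul, norm_zpow, norm_cayley, one_zpow, mul_one, norm_pow]
    gcongr
    refine (norm_sub_le _ _).trans ?_
    rw [norm_inv, norm_cayley]
    norm_num

/-- Hankel entries of the cut-off Chebyshev polynomials at multiples of `2 M + 1`. -/
theorem integral_cutChebyshev (M : ℕ) {a b : ℕ} (ha : 0 < a) (hb : 0 < b) :
    ∫ x, 2 * (((cutChebyshev M ((2 * M + 1) * a)).eval (phiReal x) : ℝ) : ℂ) *
      (cayley x ^ ((2 * M + 1) * b : ℤ) + cayley x ^ (-((2 * M + 1) * b) : ℤ)) * phi x =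
    if a = b then (2 * Real.pi * (M.centralBinom / 4 ^ M : ℝ) : ℂ) else 0 := by
  have e : ∀ x, 2 * (((cutChebyshev M ((2 * M + 1) * a)).eval (phiReal x) : ℝ) : ℂ) *
      (cayley x ^ ((2 * M + 1) * b : ℤ) + cayley x ^ (-((2 * M + 1) * b) : ℤ)) * phi x =
      (-1 / 4) ^ M * (((
        (cayley x - (cayley x)⁻¹) ^ (2 * M) * cayley x ^ ((2 * M + 1) * (a + b : ℤ)) * phi x +
        (cayley x - (cayley x)⁻¹) ^ (2 * M) * cayley x ^ ((2 * M + 1) * (a - b : ℤ)) * phi x) +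
        (cayley x - (cayley x)⁻¹) ^ (2 * M) * cayley x ^ ((2 * M + 1) * (b - a : ℤ)) * phi x) +
        (cayley x - (cayley x)⁻¹) ^ (2 * M) * cayley x ^ ((2 * M + 1) * (-a - b : ℤ)) * phi x) := by
    intro x
    have h := cayley_ne_zero x
    rw [eval_cutChebyshev]
    push_cast
    rw [show (2 * M + 1) * (a + b : ℤ) = (2 * M + 1) * a + (2 * M + 1) * b by ring,
      show (2 * M + 1) * (a - b : ℤ) = (2 * M + 1) * a + -((2 * M + 1) * b) by ring,
      show (2 * M + 1) * (b - a : ℤ) = -((2 * M + 1) * a) + (2 * M + 1) * b by ring,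
      show (2 * M + 1) * (-a - b : ℤ) = -((2 * M + 1) * a) + -((2 * M + 1) * b) by ring,
      zpow_add₀ h, zpow_add₀ h, zpow_add₀ h, zpow_add₀ h]
    ring
  simp_rw [e]
  have add4 : ∀ {f₁ f₂ f₃ f₄ : ℝ → ℂ}, Integrable f₁ → Integrable f₂ → Integrable f₃ →
      Integrable f₄ → ∫ x, f₁ x + f₂ x + f₃ x + f₄ x =
        (∫ x, f₁ x) + (∫ x, f₂ x) + (∫ x, f₃ x) + ∫ x, f₄ x := by
    intro f₁ f₂ f₃ f₄ i₁ i₂ i₃ i₄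
    have i₁₂ : Integrable fun x => f₁ x + f₂ x := i₁.add i₂
    have i₁₂₃ : Integrable fun x => f₁ x + f₂ x + f₃ x := i₁₂.add i₃
    rw [integral_add i₁₂₃ i₄, integral_add i₁₂ i₃, integral_add i₁ i₂]
  rw [integral_const_mul, add4 (integrable_cutoff M _) (integrable_cutoff M _)
    (integrable_cutoff M _) (integrable_cutoff M _), integral_cutoff,
    integral_cutoff, integral_cutoff, integral_cutoff, if_neg (by omega : ¬ ((a : ℤ) + b = 0)),
    if_neg (by omega : ¬ (-(a : ℤ) - b = 0))]
  by_cases hab : a = b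
  · subst hab
    have h4 : ((-1 : ℂ) / 4) ^ M * (-1) ^ M = (4 ^ M)⁻¹ := by
      rw [← mul_pow, ← inv_pow]; norm_num
    simp only [sub_self, if_true]
    push_cast
    rw [div_eq_mul_inv _ ((4 : ℂ) ^ M), ← h4]
    ring
  · rw [if_neg (by omega : ¬ ((a : ℤ) - b = 0)), if_neg (by omega : ¬ ((b : ℤ) - a = 0)),
      if_neg hab]
    simp

/-! ### The rank of `A - B` -/

/-- The Fourier transform `π e^{-2π|t|}` of `φ` (with the value `0` at `t = 0`). -/
def poissonFn (t : ℝ) : ℂ := Real.pi * (laguerreFn 0 t + laguerreFn 0 (-t))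

theorem conj_laguerreFn_zero (t : ℝ) : (starRingEnd ℂ) (laguerreFn 0 t) = laguerreFn 0 t := by
  by_cases ht : t ∈ Ioi (0 : ℝ)
  · simp only [laguerreFn, indicator_of_mem ht, pow_zero, one_mul, ← Complex.exp_conj]
    have h2 : (starRingEnd ℂ) 2 = 2 := map_ofNat _ 2
    simp [h2]
  · simp [laguerreFn, indicator_of_notMem ht]

theorem conj_poissonFn (t : ℝ) : (starRingEnd ℂ) (poissonFn t) = poissonFn t := by
  rw [poissonFn, map_mul, map_add, conj_laguerreFn_zero, conj_laguerreFn_zero, Complex.conj_ofReal]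

theorem integrable_poissonFn_sub (ξ : ℝ) : Integrable fun t => poissonFn (t - ξ) := by
  have h : Integrable poissonFn :=
    ((integrable_laguerreFn 0).add (integrable_laguerreFn 0).comp_neg).const_mul _
  exact h.comp_sub_right ξ

theorem memLp_laguerreFn_neg (k : ℕ) : MemLp (fun t => laguerreFn k (-t)) 2 :=
  (memLp_laguerreFn k).comp_measurePreserving (Measure.measurePreserving_neg volume)

theorem memLp_poissonFn_sub (ξ : ℝ) : MemLp (fun t => poissonFn (t - ξ)) 2 := by
  have h : MemLp poissonFn 2 :=
    ((memLp_laguerreFn 0).add (memLp_laguerreFn_neg 0)).const_mul _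
  exact h.comp_measurePreserving (measurePreserving_sub_right volume ξ)

theorem fourierInv_poissonFn (x : ℝ) : 𝓕⁻ poissonFn x = phi x := by
  have hadd : 𝓕⁻ poissonFn x =
      Real.pi * (𝓕⁻ (laguerreFn 0) x + 𝓕⁻ (laguerreFn 0) (-x)) := by
    have e : 𝓕⁻ (laguerreFn 0) (-x) = 𝓕⁻ (fun t => laguerreFn 0 (-t)) x :=
      (Real.fourierInv_comp_linearIsometry (LinearIsometryEquiv.neg ℝ (E := ℝ))
        (laguerreFn 0) x).symm
    have hi : ∀ {f : ℝ → ℂ}, Integrable f →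
        Integrable fun v : ℝ => Complex.exp (↑(2 * Real.pi * inner ℝ v x) * Complex.I) • f v := by
      intro f hf
      refine hf.bdd_mul (c := 1) (Continuous.aestronglyMeasurable (by fun_prop))
        (Eventually.of_forall fun v => ?_)
      rw [Complex.norm_exp_ofReal_mul_I]
    rw [e, Real.fourierInv_eq', Real.fourierInv_eq', Real.fourierInv_eq',
      ← integral_add (hi (integrable_laguerreFn 0)) (hi (integrable_laguerreFn 0).comp_neg),
      ← integral_const_mul]
    refine integral_congr_ae (Eventually.of_forall fun v => ?_)
    simp only [poissonFn, smul_eq_mul]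
    ring
  rw [hadd, fourierInv_laguerreFn, fourierInv_laguerreFn, phi, Complex.ofReal_inv,
    ← sq_add_one_eq]
  have h := ofReal_add_I_ne_zero x
  have h' := ofReal_sub_I_ne_zero x
  have h'' := ofReal_add_I_ne_zero (-x)
  have hpi : (Real.pi : ℂ) ≠ 0 := by exact_mod_cast Real.pi_ne_zero
  push_cast at h'' ⊢
  rw [show -(x : ℂ) + Complex.I = -(x - Complex.I) by ring] at *
  have hI := Complex.I_ne_zero
  simp only [pow_one, Nat.factorial_zero, Nat.cast_one]
  field_simp
  ring

/-- The modulated function `φ(x) e^{2πixξ}`. -/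
def modPhi (ξ x : ℝ) : ℂ := phi x * Complex.exp (2 * Real.pi * x * ξ * Complex.I)

theorem memLp_phi_two : MemLp phi 2 := by
  rw [memLp_two_iff_integrable_sq_norm continuous_phi.aestronglyMeasurable]
  refine integrable_inv_one_add_sq.mono' (by have := continuous_phi; fun_prop)
    (Eventually.of_forall fun x => ?_)
  have h := phiReal_mem_Icc x
  rw [phi_eq, Complex.norm_real, norm_pow, norm_norm, Real.norm_of_nonneg h.1, add_comm 1]
  exact pow_le_of_le_one h.1 h.2 two_ne_zero

theorem norm_modPhi (ξ x : ℝ) : ‖modPhi ξ x‖ = ‖phi x‖ := by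
  rw [modPhi, norm_mul]
  have : (2 * Real.pi * x * ξ * Complex.I : ℂ) = ((2 * Real.pi * x * ξ : ℝ) : ℂ) * Complex.I := by
    push_cast; ring
  rw [this, Complex.norm_exp_ofReal_mul_I, mul_one]

theorem memLp_modPhi (ξ : ℝ) : MemLp (modPhi ξ) 2 := by
  refine memLp_phi_two.of_le ?_ (Eventually.of_forall fun x => (norm_modPhi ξ x).le)
  unfold modPhi
  exact (continuous_phi.mul (by fun_prop)).aestronglyMeasurable

theorem fourierInv_poissonFn_sub (ξ x : ℝ) :
    𝓕⁻ (fun t => poissonFn (t - ξ)) x = modPhi ξ x := by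
  rw [modPhi, ← fourierInv_poissonFn, Real.fourierInv_eq', Real.fourierInv_eq',
    ← integral_mul_const, ← integral_add_right_eq_self _ ξ]
  refine integral_congr_ae (Eventually.of_forall fun t => ?_)
  simp only [smul_eq_mul, add_sub_cancel_right]
  rw [mul_right_comm _ (poissonFn t), ← Complex.exp_add]
  congr 2
  simp
  ring

theorem fourier_modPhi (ξ : ℝ) :
    Lp.fourierTransformₗᵢ ℝ ℂ ((memLp_modPhi ξ).toLp _) = (memLp_poissonFn_sub ξ).toLp _ := by
  rw [← fourier_symm_toLp_eq (integrable_poissonFn_sub ξ) (memLp_poissonFn_sub ξ)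
    (memLp_modPhi ξ) (fourierInv_poissonFn_sub ξ), LinearIsometryEquiv.apply_symm_apply]

/-- On the Fourier side, multiplication by `φ` is convolution with `π e^{-2π|·|}`. -/
theorem fourier_mulOp_phi (g : L2) :
    Lp.fourierTransformₗᵢ ℝ ℂ (mulOp phi memLp_phi g) =ᵐ[volume]
      fun ξ => ∫ η, poissonFn (η - ξ) * Lp.fourierTransformₗᵢ ℝ ℂ g η := by
  have hf : Integrable fun x => phi x * g x := memLp_phi_two.integrable_mul (Lp.memLp g)
  have hf2 : MemLp (fun x => phi x * g x) 2 := by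
    refine (Lp.memLp (mulOp phi memLp_phi g)).ae_eq (coeFn_mulOp phi memLp_phi g)
  have e : mulOp phi memLp_phi g = hf2.toLp _ :=
    Lp.ext ((coeFn_mulOp phi memLp_phi g).trans hf2.coeFn_toLp.symm)
  rw [e]
  refine (fourier_toLp_ae hf hf2).trans (Eventually.of_forall fun ξ => ?_)
  have h1 : 𝓕 (fun x => phi x * g x) ξ = inner ℂ ((memLp_modPhi ξ).toLp _) g := by
    rw [L2.inner_def, Real.fourier_eq']
    refine integral_congr_ae ?_
    filter_upwards [(memLp_modPhi ξ).coeFn_toLp] with x hx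
    rw [hx, RCLike.inner_apply (modPhi ξ x) (g x), modPhi, map_mul, phi_eq,
      Complex.conj_ofReal, ← Complex.exp_conj, smul_eq_mul, mul_comm (g x), mul_comm (Complex.exp _),
      mul_right_comm]
    have h2 : (starRingEnd ℂ) 2 = 2 := map_ofNat _ 2
    congr 2
    simp [h2]
    ring_nf
  rw [h1, ← (Lp.fourierTransformₗᵢ ℝ ℂ).inner_map_map, fourier_modPhi, L2.inner_def]
  refine integral_congr_ae ?_
  filter_upwards [(memLp_poissonFn_sub ξ).coeFn_toLp] with η hη
  rw [hη, RCLike.inner_apply, conj_poissonFn, mul_comm]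

theorem laguerreFn_zero_of_pos {t : ℝ} (ht : 0 < t) :
    laguerreFn 0 t = Complex.exp (-(2 * Real.pi : ℂ) * t) := by
  simp [laguerreFn, indicator_of_mem (show t ∈ Ioi (0 : ℝ) from ht)]

theorem laguerreFn_of_nonpos (k : ℕ) {t : ℝ} (ht : t ≤ 0) : laguerreFn k t = 0 :=
  indicator_of_notMem (by simpa using ht) _

/-- The kernel of `A - B` on the Fourier side is supported where `ξ` and `η` have opposite signs,
and it has separated variables there. -/
theorem poissonFn_mul_sign {ξ η : ℝ} (hξ : ξ ≠ 0) (hη : η ≠ 0) :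
    poissonFn (η - ξ) * ((SignType.sign ξ : ℂ) * (SignType.sign η : ℂ) - 1) =
      -2 * Real.pi * (laguerreFn 0 ξ * laguerreFn 0 (-η) + laguerreFn 0 (-ξ) * laguerreFn 0 η) := by
  rcases lt_or_gt_of_ne hξ with hξ | hξ <;> rcases lt_or_gt_of_ne hη with hη | hη
  · rw [laguerreFn_of_nonpos 0 hξ.le, laguerreFn_of_nonpos 0 hη.le]
    simp [hξ, hη]
  · rw [poissonFn, laguerreFn_of_nonpos 0 hξ.le, laguerreFn_of_nonpos 0 (neg_nonpos.2 hη.le),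
      laguerreFn_of_nonpos 0 (by linarith : -(η - ξ) ≤ 0), laguerreFn_zero_of_pos hη,
      laguerreFn_zero_of_pos (neg_pos.2 hξ), laguerreFn_zero_of_pos (by linarith : 0 < η - ξ),
      ← Complex.exp_add]
    have : -(2 * Real.pi : ℂ) * ((-ξ : ℝ) : ℂ) + -(2 * Real.pi) * η =
      -(2 * Real.pi : ℂ) * ((η - ξ : ℝ) : ℂ) := by push_cast; ring
    rw [this]
    simp [hξ, hη]
    ring
  · rw [poissonFn, laguerreFn_of_nonpos 0 hη.le, laguerreFn_of_nonpos 0 (neg_nonpos.2 hξ.le),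
      laguerreFn_of_nonpos 0 (by linarith : η - ξ ≤ 0), laguerreFn_zero_of_pos hξ,
      laguerreFn_zero_of_pos (neg_pos.2 hη), laguerreFn_zero_of_pos (by linarith : 0 < -(η - ξ)),
      ← Complex.exp_add]
    have : -(2 * Real.pi : ℂ) * ξ + -(2 * Real.pi) * ((-η : ℝ) : ℂ) =
      -(2 * Real.pi : ℂ) * ((-(η - ξ) : ℝ) : ℂ) := by push_cast; ring
    rw [this]
    simp [hξ, hη]
    ring
  · rw [laguerreFn_of_nonpos 0 (neg_nonpos.2 hξ.le), laguerreFn_of_nonpos 0 (neg_nonpos.2 hη.le)]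
    simp [hξ, hη]

theorem coeFn_evenFn_zero : (evenFn 0 : L2) =ᵐ[volume] fun x => -2 * Complex.I * phi x := by
  filter_upwards [coeFn_evenFn 0] with x hx
  have h := ofReal_add_I_ne_zero x
  have h' := ofReal_sub_I_ne_zero x
  rw [hx, phi, Complex.ofReal_inv, ← sq_add_one_eq, hardyFn, hardyFn]
  simp only [CharP.cast_eq_zero, zpow_zero, neg_zero, zero_sub, zpow_neg_one, cayley, inv_div]
  field_simp
  ring

theorem fourier_evenFn_zero :
    Lp.fourierTransformₗᵢ ℝ ℂ (evenFn 0 : L2) =ᵐ[volume] fun ξ => -2 * Complex.I * poissonFn ξ := by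
  have e : (evenFn 0 : L2) = (-2 * Complex.I) • (memLp_modPhi 0).toLp _ := by
    apply Lp.ext
    filter_upwards [coeFn_evenFn_zero, Lp.coeFn_smul (-2 * Complex.I) ((memLp_modPhi 0).toLp _),
      (memLp_modPhi 0).coeFn_toLp] with x h1 h2 h3
    rw [h1, h2, Pi.smul_apply, h3, modPhi]
    simp
  rw [e, map_smul, fourier_modPhi]
  filter_upwards [Lp.coeFn_smul (-2 * Complex.I) ((memLp_poissonFn_sub 0).toLp _),
    (memLp_poissonFn_sub 0).coeFn_toLp] with x h1 h2
  rw [h1, Pi.smul_apply, h2, sub_zero, smul_eq_mul]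

/-- `A - B` maps every even function to a multiple of `φ`. -/
theorem opA_sub_opB_eq (u : evenL2) :
    (opA - opB) u = (-Complex.I * ∫ η, laguerreFn 0 η * Lp.fourierTransformₗᵢ ℝ ℂ (u : L2) η) •
      evenFn 0 := by
  set U := Lp.fourierTransformₗᵢ ℝ ℂ (u : L2) with hU
  set c := ∫ η, laguerreFn 0 η * U η with hc
  have hUeven : ∀ᵐ η : ℝ, U (-η) = U η := by
    have h : reflect U = U := by
      rw [hU, ← fourier_reflect, (mem_evenL2_iff _).1 u.2]
    exact (mem_evenL2_iff U).2 h
  have hc' : ∫ η, laguerreFn 0 (-η) * U η = c := by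
    rw [hc, ← integral_neg_eq_self]
    refine integral_congr_ae ?_
    filter_upwards [hUeven] with η hη
    rw [neg_neg, hη]
  have hi : Integrable fun η => laguerreFn 0 η * U η :=
    (memLp_laguerreFn 0).integrable_mul (Lp.memLp U)
  have hi' : Integrable fun η => laguerreFn 0 (-η) * U η :=
    (memLp_laguerreFn_neg 0).integrable_mul (Lp.memLp U)
  apply Subtype.ext
  apply (Lp.fourierTransformₗᵢ ℝ ℂ).injective
  have e1 : (((opA - opB) u : evenL2) : L2) =
      -hilbertCLM (mulOp phi memLp_phi (hilbertCLM u)) - mulOp phi memLp_phi u := rfl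
  have e2 : (((-Complex.I * c) • evenFn 0 : evenL2) : L2) = (-Complex.I * c) • (evenFn 0 : L2) :=
    rfl
  rw [e1, e2, map_sub, map_neg, map_smul]
  apply Lp.ext
  have h0 : ∀ᵐ ξ : ℝ, ξ ≠ 0 := by simp [ae_iff]
  filter_upwards [Lp.coeFn_sub
      (-Lp.fourierTransformₗᵢ ℝ ℂ (hilbertCLM (mulOp phi memLp_phi (hilbertCLM u))))
      (Lp.fourierTransformₗᵢ ℝ ℂ (mulOp phi memLp_phi u)),
    Lp.coeFn_neg (Lp.fourierTransformₗᵢ ℝ ℂ (hilbertCLM (mulOp phi memLp_phi (hilbertCLM u)))),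
    fourier_hilbertCLM (mulOp phi memLp_phi (hilbertCLM u)),
    fourier_mulOp_phi (hilbertCLM u), fourier_mulOp_phi u,
    Lp.coeFn_smul (-Complex.I * c) (Lp.fourierTransformₗᵢ ℝ ℂ (evenFn 0 : L2)),
    fourier_evenFn_zero, h0] with ξ h1 h2 h3 h4 h5 h6 h7 h8
  rw [h1, Pi.sub_apply, h2, Pi.neg_apply, h3, h4, h5, h6, Pi.smul_apply, h7, ← integral_const_mul,
    ← integral_neg]
  have hiE : ∀ f : L2, Integrable fun η => poissonFn (η - ξ) * f η := fun f =>
    (memLp_poissonFn_sub ξ).integrable_mul (Lp.memLp f)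
  have hiE' : Integrable fun η => -(-Complex.I * (SignType.sign ξ : ℂ) * (poissonFn (η - ξ) *
      Lp.fourierTransformₗᵢ ℝ ℂ (hilbertCLM u) η)) := ((hiE _).const_mul _).neg
  rw [← integral_sub hiE' (hiE _)]
  have key : ∫ η, (-(-Complex.I * (SignType.sign ξ : ℂ) * (poissonFn (η - ξ) *
      Lp.fourierTransformₗᵢ ℝ ℂ (hilbertCLM u) η)) - poissonFn (η - ξ) * U η) =
      ∫ η, ((-2 * Real.pi * laguerreFn 0 ξ) * (laguerreFn 0 (-η) * U η) +
        (-2 * Real.pi * laguerreFn 0 (-ξ)) * (laguerreFn 0 η * U η)) := by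
    refine integral_congr_ae ?_
    filter_upwards [fourier_hilbertCLM (u : L2), h0] with η h9 h10
    have hk := poissonFn_mul_sign h8 h10
    rw [h9]
    linear_combination U η * hk - (poissonFn (η - ξ) * (SignType.sign ξ : ℂ) *
      (SignType.sign η : ℂ) * U η) * Complex.I_sq
  rw [key, integral_add (hi'.const_mul _) (hi.const_mul _), integral_const_mul, integral_const_mul,
    hc', ← hc, poissonFn, smul_eq_mul]
  linear_combination (-2 * c * Real.pi * (laguerreFn 0 ξ + laguerreFn 0 (-ξ))) * Complex.I_sq

theorem opA_sub_opB_evenFn_zero_ne_zero : (opA - opB) (evenFn 0) ≠ 0 := by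
  intro h
  have h2 : opA (evenFn 0) = opB (evenFn 0) := sub_eq_zero.1 h
  have hP : cutChebyshev 0 1 = 1 - Polynomial.C 2 * Polynomial.X := by
    simp [cutChebyshev, ← Polynomial.C_ofNat]
  have h1 := inner_aeval_sub (cutChebyshev 0 1) 0 0
  have h3 := integral_cutChebyshev 0 one_pos one_pos
  have h4 : Polynomial.aeval opA (cutChebyshev 0 1) (evenFn 0) =
      Polynomial.aeval opB (cutChebyshev 0 1) (evenFn 0) := by
    rw [hP]
    simp [h2, mul_apply_eq_comp]
  rw [h4, sub_self] at h1
  norm_num at h1 h3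
  rw [h3] at h1
  simp at h1

theorem rank_opA_sub_opB :
    ((opA - opB : evenL2 →L[ℂ] evenL2) : evenL2 →ₗ[ℂ] evenL2).rank = 1 := by
  have hne := opA_sub_opB_evenFn_zero_ne_zero
  rw [LinearMap.rank, rank_submodule_eq_one_iff]
  refine ⟨(opA - opB) (evenFn 0), ⟨evenFn 0, rfl⟩, hne, ?_⟩
  rintro _ ⟨u, rfl⟩
  rw [Submodule.mem_span_singleton]
  have h0 := opA_sub_opB_eq (evenFn 0)
  set c := -Complex.I * ∫ η, laguerreFn 0 η * Lp.fourierTransformₗᵢ ℝ ℂ (evenFn 0 : L2) η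
  have hc : c ≠ 0 := by
    intro hc
    rw [hc, zero_smul] at h0
    exact hne h0
  refine ⟨(-Complex.I * ∫ η, laguerreFn 0 η * Lp.fourierTransformₗᵢ ℝ ℂ (u : L2) η) * c⁻¹, ?_⟩
  rw [h0, smul_smul, mul_assoc, inv_mul_cancel₀ hc, mul_one]
  exact (opA_sub_opB_eq u).symm

/-! ### Finite differences -/

theorem abs_fwdDiff_iter_le_of_bound {f : ℝ → ℝ} {K : ℝ} (hf : ∀ x, |f x| ≤ K) (m : ℕ) (t x : ℝ) :
    |((fwdDiff t)^[m] f) x| ≤ 2 ^ m * K := by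
  induction m generalizing f K with
  | zero => simpa using hf x
  | succ m ih =>
    rw [Function.iterate_succ_apply, pow_succ, mul_assoc]
    refine ih fun y => ?_
    rw [fwdDiff, two_mul]
    exact (abs_sub _ _).trans (add_le_add (hf _) (hf _))

/-- An `m`-th difference is controlled by the `m`-th derivative. The successive derivatives are
given as a sequence of functions. -/
theorem abs_fwdDiff_iter_le_of_hasDerivAt {G : ℕ → ℝ → ℝ} {m : ℕ} {K : ℝ}
    (hG : ∀ i < m, ∀ y, HasDerivAt (G i) (G (i + 1) y) y) (hK : ∀ y, |G m y| ≤ K) (t x : ℝ) :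
    |((fwdDiff t)^[m] (G 0)) x| ≤ K * |t| ^ m := by
  induction m generalizing G K with
  | zero => simpa using hK x
  | succ m ih =>
    rw [Function.iterate_succ_apply, pow_succ', ← mul_assoc]
    refine ih (G := fun i => fwdDiff t (G i)) (fun i hi y => ?_) fun y => ?_
    · exact ((hG i (by omega) (y + t)).comp_add_const y t).sub (hG i (by omega) y)
    · have h := convex_univ.norm_image_sub_le_of_norm_hasDerivWithin_le (f := G m)
        (f' := G (m + 1)) (C := K) (fun z _ => (hG m (by omega) z).hasDerivWithinAt)
        (fun z _ => hK z) (mem_univ y) (mem_univ (y + t))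
      simpa [fwdDiff] using h

theorem fwdDiff_iter_comp_affine (f : ℝ → ℝ) (m : ℕ) (b c t x : ℝ) :
    ((fwdDiff t)^[m] fun s => f (b - c * s)) x = ((fwdDiff (-(c * t)))^[m] f) (b - c * x) := by
  induction m generalizing f with
  | zero => rfl
  | succ m ih =>
    have e : (fwdDiff t fun s => f (b - c * s)) =
        fun s => fwdDiff (-(c * t)) f (b - c * s) := by
      ext s
      simp only [fwdDiff]
      congr 2
      ring
    rw [Function.iterate_succ_apply, Function.iterate_succ_apply, ← ih, e]

theorem hasSum_fwdDiff_iter {f : ℕ → ℝ → ℝ} {h : ℝ → ℝ}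
    (hf : ∀ x, HasSum (fun k => f k x) (h x)) (m : ℕ) (t x : ℝ) :
    HasSum (fun k => ((fwdDiff t)^[m] (f k)) x) (((fwdDiff t)^[m] h) x) := by
  induction m generalizing f h with
  | zero => exact hf x
  | succ m ih =>
    simp only [Function.iterate_succ_apply]
    exact ih fun y => (hf (y + t)).sub (hf y)

/-! ### Lacunary series in the Hölder–Zygmund class -/

/-- The terms with frequency `2 ^ k ≤ 1 / τ` are summed by means of the bound `(2 ^ k τ) ^ m`, the
others by means of the uniform bound. -/
theorem sum_min_le {a K A : ℝ} {m : ℕ} (ha0 : 0 < a) (ha1 : a < 1) (ha2 : 1 < 2 ^ m * a)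
    (hK : 0 ≤ K) (hA : 0 ≤ A) {D : ℕ → ℝ} {τ : ℝ} {n : ℕ} (hτ0 : 0 ≤ τ) (hτ : τ ≤ (1 / 2) ^ n)
    (h1 : ∀ k, |D k| ≤ A) (h2 : ∀ k, |D k| ≤ K * (2 ^ k * τ) ^ m) :
    |∑' k, a ^ k * D k| ≤ a ^ n * (K * (1 - (2 ^ m * a)⁻¹)⁻¹ + A * (1 - a)⁻¹) := by
  have hg : Summable fun k : ℕ => a ^ k * A :=
    (summable_geometric_of_lt_one ha0.le ha1).mul_right A
  have hb : ∀ k, |a ^ k * D k| ≤ a ^ k * A := fun k => by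
    rw [abs_mul, abs_of_pos (pow_pos ha0 k)]
    exact mul_le_mul_of_nonneg_left (h1 k) (pow_pos ha0 k).le
  have hs : Summable fun k => |a ^ k * D k| := hg.of_nonneg_of_le (fun _ => abs_nonneg _) hb
  set ρ := (2 ^ m * a)⁻¹ with hρ
  have hρ0 : 0 < ρ := by positivity
  have hρ1 : ρ < 1 := inv_lt_one_of_one_lt₀ ha2
  have hlow : ∑ k ∈ Finset.range (n + 1), |a ^ k * D k| ≤ a ^ n * (K * (1 - ρ)⁻¹) := by
    calc ∑ k ∈ Finset.range (n + 1), |a ^ k * D k|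
        ≤ ∑ k ∈ Finset.range (n + 1), a ^ n * K * ρ ^ (n + 1 - 1 - k) := by
          refine Finset.sum_le_sum fun k hk => ?_
          obtain ⟨j, rfl⟩ : ∃ j, n = k + j :=
            Nat.exists_eq_add_of_le (by simpa [Nat.lt_succ_iff] using hk)
          rw [abs_mul, abs_of_pos (pow_pos ha0 k)]
          have e1 : (2 : ℝ) ^ k * τ ≤ (1 / 2) ^ j := by
            calc (2 : ℝ) ^ k * τ ≤ 2 ^ k * (1 / 2) ^ (k + j) := by gcongr
              _ = (2 * (1 / 2)) ^ k * (1 / 2) ^ j := by rw [pow_add, mul_pow, mul_assoc]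
              _ = (1 / 2) ^ j := by norm_num
          have e2 : ((2 : ℝ) ^ k * τ) ^ m ≤ ((1 / 2) ^ j) ^ m := by gcongr
          have e3 : a ^ (k + j) * K * ρ ^ (k + j + 1 - 1 - k) = a ^ k * (K * ((1 / 2) ^ j) ^ m) := by
            rw [show k + j + 1 - 1 - k = j by omega, hρ, mul_inv, mul_pow, pow_add, inv_pow, inv_pow,
              one_div, inv_pow, inv_pow, ← pow_mul, ← pow_mul, mul_comm m j]
            have := pow_pos ha0 j
            field_simp
          rw [e3]
          exact mul_le_mul_of_nonneg_left ((h2 k).trans (mul_le_mul_of_nonneg_left e2 hK))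
            (pow_pos ha0 k).le
      _ = a ^ n * K * ∑ k ∈ Finset.range (n + 1), ρ ^ k := by
          rw [← Finset.mul_sum, Finset.sum_range_reflect]
      _ ≤ a ^ n * K * (1 - ρ)⁻¹ := by
          refine mul_le_mul_of_nonneg_left ?_ (by positivity)
          rw [← tsum_geometric_of_lt_one hρ0.le hρ1]
          exact (summable_geometric_of_lt_one hρ0.le hρ1).sum_le_tsum _
            fun _ _ => by positivity
      _ = a ^ n * (K * (1 - ρ)⁻¹) := mul_assoc _ _ _
  have hhigh : ∑' k, |a ^ (k + (n + 1)) * D (k + (n + 1))| ≤ a ^ n * (A * (1 - a)⁻¹) := by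
    have hle : ∀ k, |a ^ (k + (n + 1)) * D (k + (n + 1))| ≤ a ^ k * (a ^ n * A) := fun k => by
      refine (hb _).trans ?_
      rw [pow_add, mul_assoc]
      gcongr ?_ * (?_ * ?_)
      exact pow_le_pow_of_le_one ha0.le ha1.le (Nat.le_succ n)
    calc ∑' k, |a ^ (k + (n + 1)) * D (k + (n + 1))|
        ≤ ∑' k, a ^ k * (a ^ n * A) :=
          ((summable_nat_add_iff (n + 1)).2 hs).tsum_le_tsum hle
            ((summable_geometric_of_lt_one ha0.le ha1).mul_right _)
      _ = a ^ n * (A * (1 - a)⁻¹) := by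
          rw [tsum_mul_right, tsum_geometric_of_lt_one ha0.le ha1]
          ring
  calc |∑' k, a ^ k * D k| ≤ ∑' k, |a ^ k * D k| := by
        simpa [Real.norm_eq_abs] using norm_tsum_le_tsum_norm (f := fun k => a ^ k * D k) (by
          simpa [Real.norm_eq_abs] using hs)
    _ = ∑ k ∈ Finset.range (n + 1), |a ^ k * D k| +
          ∑' k, |a ^ (k + (n + 1)) * D (k + (n + 1))| := (hs.sum_add_tsum_nat_add (n + 1)).symm
    _ ≤ _ := by rw [mul_add]; exact add_le_add hlow hhigh

/-- A series `∑ 2^{-αk} f_k` of bounded functions `f_k` with `m`-th differences of frequency `2^k`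
belongs to the Hölder–Zygmund class. -/
theorem memHolderZygmund_tsum {α : ℝ} (hα : 0 < α) {f : ℕ → ℝ → ℝ} {K : ℝ} (hK : 0 ≤ K)
    (hc : ∀ k, Continuous (f k)) (hb : ∀ k x, |f k x| ≤ 1)
    (hd : ∀ k t x, |((fwdDiff t)^[⌊α⌋₊ + 1] (f k)) x| ≤ K * (2 ^ k * |t|) ^ (⌊α⌋₊ + 1)) :
    MemHolderZygmund α fun x => ∑' k, ((2 : ℝ) ^ (-α)) ^ k * f k x := by
  set a : ℝ := (2 : ℝ) ^ (-α) with ha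
  set m := ⌊α⌋₊ + 1 with hm
  have ha0 : 0 < a := by positivity
  have ha1 : a < 1 := Real.rpow_lt_one_of_one_lt_of_neg one_lt_two (neg_lt_zero.2 hα)
  have ha2 : 1 < 2 ^ m * a := by
    rw [ha, ← Real.rpow_natCast, ← Real.rpow_add two_pos]
    refine Real.one_lt_rpow one_lt_two ?_
    have := Nat.lt_floor_add_one α
    rw [hm]
    push_cast
    linarith
  have hg : Summable fun k : ℕ => a ^ k := summable_geometric_of_lt_one ha0.le ha1
  have hb' : ∀ k x, |a ^ k * f k x| ≤ a ^ k := fun k x => by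
    rw [abs_mul, abs_of_pos (pow_pos ha0 k)]
    exact mul_le_of_le_one_right (pow_pos ha0 k).le (hb k x)
  refine ⟨continuous_tsum (fun k => (hc k).const_mul _) hg hb', ?_⟩
  set B := K * (1 - (2 ^ m * a)⁻¹)⁻¹ + 2 ^ m * (1 - a)⁻¹ with hB
  have hB0 : 0 ≤ B := by
    have h1 : (2 ^ m * a)⁻¹ < 1 := inv_lt_one_of_one_lt₀ ha2
    have h2 : 0 ≤ (1 - (2 ^ m * a)⁻¹)⁻¹ := inv_nonneg.2 (by linarith)
    have h3 : 0 ≤ (1 - a)⁻¹ := inv_nonneg.2 (by linarith)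
    positivity
  refine ⟨2 ^ α * B, fun t x => ?_⟩
  have hsum : ((fwdDiff t)^[m] fun x => ∑' k, a ^ k * f k x) x =
      ∑' k, a ^ k * ((fwdDiff t)^[m] (f k)) x := by
    have h := hasSum_fwdDiff_iter (f := fun k x => a ^ k * f k x)
      (fun x => (Summable.of_norm_bounded hg fun k => hb' k x).hasSum) m t x
    rw [← h.tsum_eq]
    refine tsum_congr fun k => ?_
    exact congrFun (fwdDiff_iter_const_smul t (a ^ k) (f k) m) x
  have h1 : ∀ k, |((fwdDiff t)^[m] (f k)) x| ≤ 2 ^ m := fun k => by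
    simpa using abs_fwdDiff_iter_le_of_bound (hb k) m t x
  rw [hsum]
  have hp : (0 : ℝ) ≤ 2 ^ m := by positivity
  rcases eq_or_ne t 0 with rfl | ht
  · have h0 : ∀ k, ((fwdDiff (0 : ℝ))^[m] (f k)) x = 0 := fun k => by
      have := hd k 0 x
      rw [abs_zero, mul_zero, zero_pow (by omega), mul_zero] at this
      exact abs_nonpos_iff.1 this
    simp [h0, Real.zero_rpow hα.ne']
  · have ht0 : 0 < |t| := abs_pos.2 ht
    rcases le_or_gt |t| 1 with ht1 | ht1
    · obtain ⟨n, hn1, hn2⟩ := exists_nat_pow_near_of_lt_one ht0 ht1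
        (by norm_num : (0 : ℝ) < 1 / 2) (by norm_num)
      refine (sum_min_le ha0 ha1 ha2 hK hp ht0.le hn2 h1 fun k => hd k t x).trans ?_
      have e : a ^ n ≤ 2 ^ α * |t| ^ α := by
        rw [← Real.mul_rpow zero_le_two ht0.le]
        have e1 : a ^ n = ((1 / 2 : ℝ) ^ n) ^ α := by
          rw [ha, Real.rpow_neg zero_le_two, ← Real.inv_rpow zero_le_two, one_div,
            ← Real.rpow_natCast, ← Real.rpow_natCast, ← Real.rpow_mul (by positivity),
            ← Real.rpow_mul (by positivity), mul_comm]
        rw [e1]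
        refine Real.rpow_le_rpow (by positivity) ?_ hα.le
        rw [pow_succ] at hn1
        linarith
      calc a ^ n * B ≤ 2 ^ α * |t| ^ α * B := mul_le_mul_of_nonneg_right e hB0
        _ = _ := by ring
    · have h2 : |∑' k, a ^ k * ((fwdDiff t)^[m] (f k)) x| ≤ 2 ^ m * (1 - a)⁻¹ := by
        have h3 : Summable fun k : ℕ => a ^ k * (2 : ℝ) ^ m := hg.mul_right _
        have h4 : ∀ k, ‖a ^ k * ((fwdDiff t)^[m] (f k)) x‖ ≤ a ^ k * 2 ^ m := fun k => by
          rw [Real.norm_eq_abs, abs_mul, abs_of_pos (pow_pos ha0 k)]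
          exact mul_le_mul_of_nonneg_left (h1 k) (pow_pos ha0 k).le
        have h5 := tsum_of_norm_bounded h3.hasSum h4
        rwa [tsum_mul_right, tsum_geometric_of_lt_one ha0.le ha1, mul_comm] at h5
      have h6 : 2 ^ m * (1 - a)⁻¹ ≤ B := by
        have h1 : (2 ^ m * a)⁻¹ < 1 := inv_lt_one_of_one_lt₀ ha2
        have h2 : 0 ≤ (1 - (2 ^ m * a)⁻¹)⁻¹ := inv_nonneg.2 (by linarith)
        have := mul_nonneg hK h2
        linarith
      have h7 : 1 ≤ 2 ^ α * |t| ^ α := by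
        rw [← Real.mul_rpow zero_le_two ht0.le]
        exact Real.one_le_rpow (by linarith) hα.le
      calc _ ≤ B := h2.trans h6
        _ ≤ (2 ^ α * |t| ^ α) * B := le_mul_of_one_le_left hB0 h7
        _ = _ := by ring

/-! ### Derivatives of the cut-off Chebyshev polynomials -/

/-- The weight `(1 - y²)₊`. -/
def weight (y : ℝ) : ℝ := max 0 (1 - y ^ 2)

theorem hasDerivAt_max_pow {a : ℕ} (ha : 1 ≤ a) (u : ℝ) :
    HasDerivAt (fun u : ℝ => max 0 u ^ (a + 1)) ((a + 1) * max 0 u ^ a) u := by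
  have ha0 : a ≠ 0 := by omega
  rcases lt_trichotomy u 0 with hu | rfl | hu
  · have h : HasDerivAt (fun _ : ℝ => (0 : ℝ)) ((a + 1) * max 0 u ^ a) u := by
      rw [max_eq_left hu.le, zero_pow ha0, mul_zero]
      exact hasDerivAt_const u 0
    refine h.congr_of_eventuallyEq ?_
    filter_upwards [gt_mem_nhds hu] with v hv
    rw [max_eq_left (le_of_lt hv), zero_pow (Nat.succ_ne_zero a)]
  · have hl : HasDerivWithinAt (fun u : ℝ => max 0 u ^ (a + 1)) ((a + 1) * max 0 (0 : ℝ) ^ a)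
        (Iic 0) 0 := by
      have h := hasDerivWithinAt_const (0 : ℝ) (Iic 0) (0 : ℝ)
      rw [max_self, zero_pow ha0, mul_zero]
      refine h.congr (fun v hv => ?_) (by simp)
      rw [max_eq_left hv, zero_pow (Nat.succ_ne_zero a)]
    have hr : HasDerivWithinAt (fun u : ℝ => max 0 u ^ (a + 1)) ((a + 1) * max 0 (0 : ℝ) ^ a)
        (Ici 0) 0 := by
      have h := (hasDerivAt_pow (a + 1) (0 : ℝ)).hasDerivWithinAt (s := Ici 0)
      rw [max_self]
      simp only [Nat.add_sub_cancel, Nat.cast_add, Nat.cast_one] at h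
      refine h.congr (fun v hv => ?_) (by simp)
      rw [max_eq_right hv]
    have h := hl.union hr
    rwa [Iic_union_Ici, hasDerivWithinAt_univ] at h
  · have h := hasDerivAt_pow (a + 1) u
    simp only [Nat.add_sub_cancel, Nat.cast_add, Nat.cast_one] at h
    rw [max_eq_right hu.le]
    refine h.congr_of_eventuallyEq ?_
    filter_upwards [lt_mem_nhds hu] with v hv
    rw [max_eq_right (le_of_lt hv)]

theorem hasDerivAt_weight_pow {a : ℕ} (ha : 1 ≤ a) (y : ℝ) :
    HasDerivAt (fun y => weight y ^ (a + 1)) (-2 * (a + 1) * y * weight y ^ a) y := by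
  have h1 : HasDerivAt (fun y : ℝ => 1 - y ^ 2) (-(2 * y)) y := by
    simpa using (hasDerivAt_pow 2 y).const_sub 1
  have h := (hasDerivAt_max_pow ha (1 - y ^ 2)).comp y h1
  convert! h using 1
  rw [weight]
  ring

theorem weight_mul_weight_pow {a : ℕ} (ha : 1 ≤ a) (y : ℝ) :
    weight y * weight y ^ a = (1 - y ^ 2) * weight y ^ a := by
  rw [weight]
  rcases le_or_gt (1 - y ^ 2) 0 with h | h
  · rw [max_eq_left h, zero_pow (by omega), mul_zero, mul_zero]
  · rw [max_eq_right h.le]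

theorem weight_nonneg (y : ℝ) : 0 ≤ weight y := le_max_left _ _

theorem weight_le_one (y : ℝ) : weight y ≤ 1 :=
  max_le zero_le_one (by nlinarith [sq_nonneg y])

theorem weight_eq_zero {y : ℝ} (hy : 1 ≤ |y|) : weight y = 0 := by
  refine max_eq_left ?_
  have := one_le_sq_iff_one_le_abs y |>.2 hy
  linarith

theorem weight_eq {y : ℝ} (hy : |y| ≤ 1) : weight y = 1 - y ^ 2 := by
  refine max_eq_right ?_
  have := sq_le_one_iff_abs_le_one y |>.2 hy
  linarith

theorem continuous_weight : Continuous weight := by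
  unfold weight
  fun_prop

section Chebyshev

open Polynomial Polynomial.Chebyshev

/-- The function `(1 - y²) U_{N-1}(y)`, which is `sin θ sin Nθ` for `y = cos θ`. -/
def chebV (N : ℕ) (y : ℝ) : ℝ := (1 - y ^ 2) * (U ℝ (N - 1)).eval y

theorem abs_eval_T_le {y : ℝ} (hy : |y| ≤ 1) (N : ℕ) : |(T ℝ N).eval y| ≤ 1 := by
  rw [← Real.cos_arccos (abs_le.1 hy).1 (abs_le.1 hy).2, T_real_cos]
  exact Real.abs_cos_le_one _

theorem abs_chebV_le {y : ℝ} (hy : |y| ≤ 1) (N : ℕ) : |chebV N y| ≤ 1 := by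
  have hc := Real.cos_arccos (abs_le.1 hy).1 (abs_le.1 hy).2
  have h : chebV N y = Real.sin (Real.arccos y) * Real.sin (N * Real.arccos y) := by
    have hU := U_real_cos (Real.arccos y) (N - 1)
    rw [hc] at hU
    push_cast at hU
    rw [sub_add_cancel] at hU
    rw [← hU, chebV]
    have hs := Real.sin_sq_add_cos_sq (Real.arccos y)
    rw [hc] at hs
    linear_combination (-(U ℝ (N - 1)).eval y) * hs
  rw [h, abs_mul]
  exact mul_le_one₀ (Real.abs_sin_le_one _) (abs_nonneg _) (Real.abs_sin_le_one _)

theorem hasDerivAt_T (N : ℕ) (y : ℝ) :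
    HasDerivAt (fun y => (T ℝ N).eval y) (N * (U ℝ (N - 1)).eval y) y := by
  have h := (T ℝ N).hasDerivAt y
  rw [T_derivative_eq_U] at h
  simpa using h

theorem hasDerivAt_chebV (N : ℕ) (y : ℝ) :
    HasDerivAt (chebV N) (-(y * (U ℝ (N - 1)).eval y) - N * (T ℝ N).eval y) y := by
  have h1 : HasDerivAt (fun y : ℝ => 1 - y ^ 2) (-(2 * y)) y := by
    simpa using (hasDerivAt_pow 2 y).const_sub 1
  have h := h1.mul ((U ℝ (N - 1)).hasDerivAt y)
  have e := congrArg (Polynomial.eval y) (add_one_mul_T_eq_poly_in_U (R := ℝ) (N - 1))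
  convert! h using 1
  simp at e
  linear_combination -e

theorem hasDerivAt_evalEval (p : Polynomial (Polynomial ℝ)) (e y : ℝ) :
    HasDerivAt (fun y => p.evalEval e y) ((derivative p).evalEval e y) y := by
  have h := (p.map (evalRingHom e)).hasDerivAt y
  rw [derivative_map] at h
  simpa only [map_evalRingHom_eval] using! h

theorem exists_bound_evalEval (p : Polynomial (Polynomial ℝ)) :
    ∃ C : ℝ, 0 ≤ C ∧ ∀ e y : ℝ, |e| ≤ 1 → |y| ≤ 1 → |p.evalEval e y| ≤ C := by
  have hcont : Continuous fun v : ℝ × ℝ => p.evalEval v.1 v.2 := by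
    induction p using Polynomial.induction_on' with
    | add p q hp hq => simpa [evalEval_add] using! hp.add hq
    | monomial n a =>
      simp only [evalEval, eval_monomial, eval_mul, eval_pow, eval_C]
      exact (a.continuous.comp continuous_fst).mul (continuous_snd.pow n)
  obtain ⟨C, hC⟩ := ((isCompact_Icc (a := (-1 : ℝ)) (b := 1)).prod
    (isCompact_Icc (a := (-1 : ℝ)) (b := 1))).exists_bound_of_continuousOn hcont.continuousOn
  refine ⟨|C|, abs_nonneg _, fun e y he hy => ?_⟩
  exact (hC (e, y) ⟨abs_le.1 he, abs_le.1 hy⟩).trans (le_abs_self C)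

/-- The coefficients `(p_i, q_i)` in the formula
`(w ^ M T_N)^{(i)} = N ^ i w ^ (M - i) (p_i(1/N, y) T_N + q_i(1/N, y) V_N)`,
where `w = (1 - y²)₊` and `V_N = chebV N`. The inner variable is `1 / N`, which makes the bounds
uniform in `N`, and the outer one is `y`. -/
def derivCoeff (M : ℕ) : ℕ → Polynomial (Polynomial ℝ) × Polynomial (Polynomial ℝ)
  | 0 => (1, 0)
  | i + 1 =>
    let p := (derivCoeff M i).1
    let q := (derivCoeff M i).2
    (C X * ((1 - X ^ 2) * derivative p - 2 * ((M - i : ℕ) : Polynomial (Polynomial ℝ)) * X * p) -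
        (1 - X ^ 2) * q,
      C X * ((1 - X ^ 2) * derivative q - 2 * ((M - i : ℕ) : Polynomial (Polynomial ℝ)) * X * q -
        X * q) + p)

/-- The `i`-th derivative of `w ^ M T_N`, for `i < M`. -/
def cutDeriv (M N i : ℕ) (y : ℝ) : ℝ :=
  N ^ i * (weight y ^ (M - i) * ((derivCoeff M i).1.evalEval (N : ℝ)⁻¹ y * (T ℝ N).eval y +
    (derivCoeff M i).2.evalEval (N : ℝ)⁻¹ y * chebV N y))

theorem hasDerivAt_cutDeriv {M N i : ℕ} (hN : 0 < N) (hi : i + 2 ≤ M) (y : ℝ) :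
    HasDerivAt (cutDeriv M N i) (cutDeriv M N (i + 1) y) y := by
  obtain ⟨a, ha⟩ : ∃ a, M - i = a + 1 := ⟨M - i - 1, by omega⟩
  have ha' : M - (i + 1) = a := by omega
  have ha1 : 1 ≤ a := by omega
  have hN' : (N : ℝ) ≠ 0 := by exact_mod_cast hN.ne'
  set p := (derivCoeff M i).1 with hp
  set q := (derivCoeff M i).2 with hq
  have h := ((hasDerivAt_weight_pow ha1 y).mul
    (((hasDerivAt_evalEval p (N : ℝ)⁻¹ y).mul (hasDerivAt_T N y)).add
      ((hasDerivAt_evalEval q (N : ℝ)⁻¹ y).mul (hasDerivAt_chebV N y)))).const_mul ((N : ℝ) ^ i)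
  have hw := weight_mul_weight_pow ha1 y
  have e1 : (derivCoeff M (i + 1)).1.evalEval (N : ℝ)⁻¹ y =
      (N : ℝ)⁻¹ * ((1 - y ^ 2) * (derivative p).evalEval (N : ℝ)⁻¹ y -
        2 * (a + 1) * y * p.evalEval (N : ℝ)⁻¹ y) - (1 - y ^ 2) * q.evalEval (N : ℝ)⁻¹ y := by
    simp [derivCoeff, evalEval, ha, hp, hq]
  have e2 : (derivCoeff M (i + 1)).2.evalEval (N : ℝ)⁻¹ y =
      (N : ℝ)⁻¹ * ((1 - y ^ 2) * (derivative q).evalEval (N : ℝ)⁻¹ y -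
        2 * (a + 1) * y * q.evalEval (N : ℝ)⁻¹ y - y * q.evalEval (N : ℝ)⁻¹ y) +
        p.evalEval (N : ℝ)⁻¹ y := by
    simp [derivCoeff, evalEval, ha, hp, hq]
  have hfun : cutDeriv M N i = fun y => (N : ℝ) ^ i * (weight y ^ (a + 1) *
      (p.evalEval (N : ℝ)⁻¹ y * (T ℝ N).eval y + q.evalEval (N : ℝ)⁻¹ y * chebV N y)) := by
    ext y
    rw [cutDeriv, ha]
  rw [hfun]
  convert! h using 1
  rw [cutDeriv, ha', e1, e2]
  simp only [Pi.add_apply, Pi.mul_apply]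
  have hNN : (N : ℝ) * (N : ℝ)⁻¹ = 1 := mul_inv_cancel₀ hN'
  generalize (derivative p).evalEval (N : ℝ)⁻¹ y = dp
  generalize (derivative q).evalEval (N : ℝ)⁻¹ y = dq
  generalize p.evalEval (N : ℝ)⁻¹ y = p0
  generalize q.evalEval (N : ℝ)⁻¹ y = q0
  rw [chebV, pow_succ (weight y) a, mul_comm (weight y ^ a) (weight y), hw, pow_succ (N : ℝ) i]
  generalize (T ℝ (N : ℤ)).eval y = t
  generalize (U ℝ ((N : ℤ) - 1)).eval y = u
  field_simp
  ring

theorem exists_bound_cutDeriv (M m : ℕ) :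
    ∃ K : ℝ, 0 ≤ K ∧ ∀ N : ℕ, 0 < N → m < M → ∀ y, |cutDeriv M N m y| ≤ K * N ^ m := by
  obtain ⟨C₁, hC₁, h₁⟩ := exists_bound_evalEval (derivCoeff M m).1
  obtain ⟨C₂, hC₂, h₂⟩ := exists_bound_evalEval (derivCoeff M m).2
  refine ⟨C₁ + C₂, by positivity, fun N hN hm y => ?_⟩
  rw [cutDeriv, abs_mul, mul_comm, abs_of_nonneg (by positivity : (0 : ℝ) ≤ (N : ℝ) ^ m)]
  refine mul_le_mul_of_nonneg_right ?_ (by positivity)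
  rcases le_total 1 |y| with hy | hy
  · rw [weight_eq_zero hy, zero_pow (by omega), zero_mul, abs_zero]
    positivity
  · have hN1 : |(N : ℝ)⁻¹| ≤ 1 := by
      rw [abs_of_nonneg (by positivity)]
      exact inv_le_one_of_one_le₀ (by exact_mod_cast hN)
    have hw : |weight y ^ (M - m)| ≤ 1 := by
      rw [abs_of_nonneg (pow_nonneg (weight_nonneg y) _)]
      exact pow_le_one₀ (weight_nonneg y) (weight_le_one y)
    rw [abs_mul]
    refine (mul_le_of_le_one_left (abs_nonneg _) hw).trans ((abs_add_le _ _).trans ?_)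
    rw [abs_mul, abs_mul]
    exact add_le_add
      ((mul_le_of_le_one_right (abs_nonneg _) (abs_eval_T_le hy N)).trans (h₁ _ y hN1 hy))
      ((mul_le_of_le_one_right (abs_nonneg _) (abs_chebV_le hy N)).trans (h₂ _ y hN1 hy))

/-! ### The function `h` -/

/-- The function `(1 - y²)₊ ^ M T_N(y)` with `y = 1 - 2 s`: the extension by zero of
`cutChebyshev M N` from `[0, 1]` to the real line. -/
def cutFn (M N : ℕ) (s : ℝ) : ℝ := weight (1 - 2 * s) ^ M * (T ℝ N).eval (1 - 2 * s)

theorem cutFn_eq_eval {M N : ℕ} {s : ℝ} (hs : s ∈ Icc (0 : ℝ) 1) :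
    cutFn M N s = (cutChebyshev M N).eval s := by
  have h : |1 - 2 * s| ≤ 1 := abs_le.2 ⟨by linarith [hs.2], by linarith [hs.1]⟩
  rw [cutFn, weight_eq h, cutChebyshev]
  simp

theorem continuous_cutFn (M N : ℕ) : Continuous (cutFn M N) := by
  unfold cutFn
  exact ((continuous_weight.comp (by fun_prop)).pow M).mul
    ((T ℝ N).continuous.comp (by fun_prop))

theorem abs_cutFn_le {M : ℕ} (hM : 0 < M) (N : ℕ) (s : ℝ) : |cutFn M N s| ≤ 1 := by
  rw [cutFn, abs_mul]
  rcases le_total 1 |1 - 2 * s| with hy | hy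
  · rw [weight_eq_zero hy, zero_pow hM.ne', abs_zero, zero_mul]
    exact zero_le_one
  · rw [abs_of_nonneg (pow_nonneg (weight_nonneg _) _)]
    exact mul_le_one₀ (pow_le_one₀ (weight_nonneg _) (weight_le_one _)) (abs_nonneg _)
      (abs_eval_T_le hy N)

theorem exists_fwdDiff_cutFn_le (m : ℕ) :
    ∃ K : ℝ, 0 ≤ K ∧ ∀ N : ℕ, 0 < N → ∀ t x,
      |((fwdDiff t)^[m] (cutFn (m + 1) N)) x| ≤ K * (N * |t|) ^ m := by
  obtain ⟨K, hK, h⟩ := exists_bound_cutDeriv (m + 1) m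
  refine ⟨K * 2 ^ m, by positivity, fun N hN t x => ?_⟩
  have h0 : cutFn (m + 1) N = fun s => cutDeriv (m + 1) N 0 (1 - 2 * s) := by
    ext s
    simp [cutFn, cutDeriv, derivCoeff]
  rw [h0, fwdDiff_iter_comp_affine]
  refine (abs_fwdDiff_iter_le_of_hasDerivAt
    (G := cutDeriv (m + 1) N) (fun i hi y => hasDerivAt_cutDeriv hN (by omega) y)
    (fun y => h N hN (Nat.lt_succ_self m) y) _ _).trans (le_of_eq ?_)
  rw [abs_neg, abs_mul, abs_two]
  ring

end Chebyshev

/-! ### Lower bounds for singular values -/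

section SingularValue

variable {E : Type*} [NormedAddCommGroup E] [InnerProductSpace ℂ E]

theorem norm_sq_sum_smul {n : ℕ} {u : Fin n → E} {r : ℝ}
    (hu : ∀ i j, inner ℂ (u i) (u j) = if i = j then (r : ℂ) else 0) (a : Fin n → ℂ) :
    ‖∑ i, a i • u i‖ ^ 2 = r * ∑ i, ‖a i‖ ^ 2 := by
  have h : inner ℂ (∑ i, a i • u i) (∑ i, a i • u i) = ((r * ∑ i, ‖a i‖ ^ 2 : ℝ) : ℂ) := by
    simp only [sum_inner, inner_sum, inner_smul_left, inner_smul_right, hu, mul_ite, mul_zero,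
      Finset.sum_ite_eq', Finset.mem_univ, if_true]
    push_cast
    rw [Finset.mul_sum]
    refine Finset.sum_congr rfl fun i _ => ?_
    rw [← Complex.conj_mul' (a i)]
    ring
  rw [inner_self_eq_norm_sq_to_K] at h
  exact Complex.ofReal_injective (by simpa using h)

/-- If `T` has a diagonal `(n + 1) × (n + 1)` block `c` with respect to two orthogonal families
of vectors of norm `√r`, then `s_n(T) ≥ c / r`. -/
theorem le_singularValue (T : E →L[ℂ] E) (n : ℕ) {u v : Fin (n + 1) → E} {r c : ℝ} (hr : 0 < r)
    (hc : 0 ≤ c) (hu : ∀ i j, inner ℂ (u i) (u j) = if i = j then (r : ℂ) else 0)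
    (hv : ∀ i j, inner ℂ (v i) (v j) = if i = j then (r : ℂ) else 0)
    (hT : ∀ i j, inner ℂ (v j) (T (u i)) = if i = j then (c : ℂ) else 0) :
    c / r ≤ singularValue T n := by
  refine le_csInf ⟨_, 0, by simp, rfl⟩ ?_
  rintro _ ⟨R, hR, rfl⟩
  -- A nonzero combination of the `n + 1` vectors `u i` is annihilated by `R`.
  obtain ⟨a, ha0, haR⟩ : ∃ a : Fin (n + 1) → ℂ, a ≠ 0 ∧ R (∑ i, a i • u i) = 0 := by
    set L : (Fin (n + 1) → ℂ) →ₗ[ℂ] E := Fintype.linearCombination ℂ u with hL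
    have hinj : ¬ Function.Injective ((R : E →ₗ[ℂ] E) ∘ₗ L) := by
      intro hinj
      have h1 : ((R : E →ₗ[ℂ] E) ∘ₗ L).rank ≤ (R : E →ₗ[ℂ] E).rank :=
        LinearMap.rank_comp_le_left _ _
      have h2 := (LinearMap.lift_rank_le_of_injective
        ((R : E →ₗ[ℂ] E) ∘ₗ L).rangeRestrict
        (fun x y h => hinj (congrArg Subtype.val h)))
      have h3 := (Cardinal.lift_le.2 (h1.trans hR))
      have h4 := h2.trans h3
      rw [rank_fin_fun] at h4
      simp only [Cardinal.lift_natCast, Nat.cast_le] at h4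
      omega
    rw [← LinearMap.ker_eq_bot, Submodule.eq_bot_iff] at hinj
    push Not at hinj
    obtain ⟨a, ha, ha0⟩ := hinj
    refine ⟨a, ha0, ?_⟩
    simpa [hL, Fintype.linearCombination_apply] using ha
  set S : ℝ := ∑ i, ‖a i‖ ^ 2 with hS
  have hS0 : 0 < S := by
    obtain ⟨i, hi⟩ := Function.ne_iff.1 ha0
    exact Finset.sum_pos' (fun j _ => by positivity)
      ⟨i, Finset.mem_univ i, by have := norm_pos_iff.2 hi; positivity⟩
  set x := ∑ i, a i • u i with hx
  set y := ∑ i, a i • v i with hy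
  have hnx : ‖x‖ ^ 2 = r * S := norm_sq_sum_smul hu a
  have hny : ‖y‖ ^ 2 = r * S := norm_sq_sum_smul hv a
  have hin : inner ℂ y ((T - R) x) = ((c * S : ℝ) : ℂ) := by
    rw [sub_apply, haR, sub_zero, hx, hy, map_sum]
    simp only [map_smul, sum_inner, inner_sum, inner_smul_left, inner_smul_right, hT, mul_ite,
      mul_zero, Finset.sum_ite_eq, Finset.mem_univ, if_true, hS]
    push_cast
    rw [Finset.mul_sum]
    refine Finset.sum_congr rfl fun i _ => ?_
    rw [← Complex.conj_mul' (a i)]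
    ring
  have hle : c * S ≤ ‖T - R‖ * (r * S) := by
    have h1 : ‖inner ℂ y ((T - R) x)‖ ≤ ‖y‖ * ‖(T - R) x‖ := norm_inner_le_norm _ _
    rw [hin, Complex.norm_real, Real.norm_of_nonneg (by positivity)] at h1
    have h2 := (T - R).le_opNorm x
    have hxy : ‖x‖ = ‖y‖ := by
      rw [← sq_eq_sq₀ (norm_nonneg _) (norm_nonneg _), hnx, hny]
    calc c * S ≤ ‖y‖ * (‖T - R‖ * ‖x‖) := h1.trans (mul_le_mul_of_nonneg_left h2 (norm_nonneg _))
      _ = ‖T - R‖ * ‖x‖ ^ 2 := by rw [hxy]; ring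
      _ = _ := by rw [hnx]
  rw [div_le_iff₀ hr]
  refine le_of_mul_le_mul_right ?_ hS0
  rwa [mul_assoc]

theorem inner_aeval_sum (S : E →L[ℂ] E) (c : ℕ → ℝ) (P : ℕ → Polynomial ℝ) (K : ℕ) (u v : E) :
    inner ℂ v (Polynomial.aeval S (∑ k ∈ Finset.range K, c k • P k) u) =
      ∑ k ∈ Finset.range K, (c k : ℂ) * inner ℂ v (Polynomial.aeval S (P k) u) := by
  rw [map_sum, sum_apply, inner_sum]
  refine Finset.sum_congr rfl fun k _ => ?_
  rw [map_smul, smul_apply, ← Complex.coe_smul, inner_smul_right]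

end SingularValue

/-! ### The lacunary symbol -/

/-- The lacunary series `c ∑ 2^{-αk} (1 - y²)₊ ^ M T_{N_k}(y)` with `y = 1 - 2 s` and
`N_k = (2 M + 1) 2 ^ k`. -/
def lacunaryFn (α c : ℝ) (M : ℕ) (s : ℝ) : ℝ :=
  c * ∑' k, ((2 : ℝ) ^ (-α)) ^ k * cutFn M ((2 * M + 1) * 2 ^ k) s

variable {α c : ℝ} {M : ℕ}

theorem rpow_neg_lt_one (hα : 0 < α) : (2 : ℝ) ^ (-α) < 1 :=
  Real.rpow_lt_one_of_one_lt_of_neg one_lt_two (neg_lt_zero.2 hα)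

theorem abs_lacunary_term_le (hM : 0 < M) (k : ℕ) (s : ℝ) :
    |((2 : ℝ) ^ (-α)) ^ k * cutFn M ((2 * M + 1) * 2 ^ k) s| ≤ ((2 : ℝ) ^ (-α)) ^ k := by
  have h : (0 : ℝ) ≤ ((2 : ℝ) ^ (-α)) ^ k := by positivity
  rw [abs_mul, abs_of_nonneg h]
  exact mul_le_of_le_one_right h (abs_cutFn_le hM _ s)

theorem summable_lacunary (hα : 0 < α) (hM : 0 < M) (s : ℝ) :
    Summable fun k => ((2 : ℝ) ^ (-α)) ^ k * cutFn M ((2 * M + 1) * 2 ^ k) s :=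
  Summable.of_norm_bounded (summable_geometric_of_lt_one (by positivity) (rpow_neg_lt_one hα))
    fun k => abs_lacunary_term_le hM k s

theorem abs_lacunaryFn_le (hα : 0 < α) (hM : 0 < M) (s : ℝ) :
    |lacunaryFn α c M s| ≤ |c| * (1 - (2 : ℝ) ^ (-α))⁻¹ := by
  rw [lacunaryFn, abs_mul]
  refine mul_le_mul_of_nonneg_left ?_ (abs_nonneg c)
  exact tsum_of_norm_bounded (f := fun k => ((2 : ℝ) ^ (-α)) ^ k * cutFn M ((2 * M + 1) * 2 ^ k) s)
    (hasSum_geometric_of_lt_one (by positivity) (rpow_neg_lt_one hα))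
    fun k => abs_lacunary_term_le hM k s

theorem MemHolderZygmund.const_mul {f : ℝ → ℝ} (hf : MemHolderZygmund α f) (c : ℝ) :
    MemHolderZygmund α fun x => c * f x := by
  obtain ⟨hc, C, hC⟩ := hf
  refine ⟨hc.const_mul c, |c| * C, fun t x => ?_⟩
  have h : ((fwdDiff t)^[⌊α⌋₊ + 1] fun x => c * f x) x =
      c * ((fwdDiff t)^[⌊α⌋₊ + 1] f) x :=
    congrFun (fwdDiff_iter_const_smul t c f _) x
  rw [h, abs_mul, mul_assoc]
  exact mul_le_mul_of_nonneg_left (hC t x) (abs_nonneg c)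

theorem memHolderZygmund_lacunaryFn (hα : 0 < α) (c : ℝ) :
    MemHolderZygmund α (lacunaryFn α c (⌊α⌋₊ + 2)) := by
  obtain ⟨K, hK, h⟩ := exists_fwdDiff_cutFn_le (⌊α⌋₊ + 1)
  refine MemHolderZygmund.const_mul (memHolderZygmund_tsum hα
    (K := K * (2 * (⌊α⌋₊ + 2 : ℕ) + 1) ^ (⌊α⌋₊ + 1)) (by positivity)
    (fun k => continuous_cutFn _ _) (fun k x => abs_cutFn_le (by omega) _ x)
    fun k t x => ?_) c
  refine (h _ (by positivity) t x).trans (le_of_eq ?_)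
  rw [mul_assoc, ← mul_pow]
  push_cast
  ring

/-- The partial sums of the lacunary series on `[0, 1]`. -/
def lacunaryPoly (α c : ℝ) (M K : ℕ) : Polynomial ℝ :=
  ∑ k ∈ Finset.range K, (c * ((2 : ℝ) ^ (-α)) ^ k) • cutChebyshev M ((2 * M + 1) * 2 ^ k)

theorem abs_lacunaryFn_sub_le (hα : 0 < α) (hM : 0 < M) (K : ℕ) {s : ℝ} (hs : s ∈ Icc (0 : ℝ) 1) :
    |lacunaryFn α c M s - (lacunaryPoly α c M K).eval s| ≤
      |c| * (1 - (2 : ℝ) ^ (-α))⁻¹ * ((2 : ℝ) ^ (-α)) ^ K := by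
  have hsum := summable_lacunary hα hM s
  have e : lacunaryFn α c M s - (lacunaryPoly α c M K).eval s =
      c * ∑' k, ((2 : ℝ) ^ (-α)) ^ (k + K) * cutFn M ((2 * M + 1) * 2 ^ (k + K)) s := by
    rw [lacunaryFn, ← hsum.sum_add_tsum_nat_add K, lacunaryPoly, Polynomial.eval_finsetSum, mul_add,
      Finset.mul_sum]
    simp only [Polynomial.eval_smul, ← cutFn_eq_eval hs, smul_eq_mul, mul_assoc]
    ring
  have hg := (hasSum_geometric_of_lt_one (by positivity) (rpow_neg_lt_one hα)).mul_right
    (((2 : ℝ) ^ (-α)) ^ K)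
  rw [e, abs_mul, mul_assoc]
  refine mul_le_mul_of_nonneg_left ?_ (abs_nonneg c)
  refine tsum_of_norm_bounded
    (f := fun k => ((2 : ℝ) ^ (-α)) ^ (k + K) * cutFn M ((2 * M + 1) * 2 ^ (k + K)) s) hg
    fun k => ?_
  rw [← pow_add]
  exact abs_lacunary_term_le hM (k + K) s

/-- The Hankel entries of `h(A) - h(B)` at frequencies `(2 M + 1) b`: only the block of the
lacunary series with `2 ^ k = b` contributes. -/
theorem inner_opFun_lacunaryFn (hα : 0 < α) (hM : 0 < M)
    (hc : Continuous (lacunaryFn α c M)) {n m b : ℕ} (hb : 0 < b)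
    (hnm : n + m + 1 = (2 * M + 1) * b) :
    inner ℂ (evenFn m) ((opFun (lacunaryFn α c M) opA - opFun (lacunaryFn α c M) opB) (evenFn n)) =
      ∑' k, if 2 ^ k = b then
        ((2 * Real.pi * (c * ((2 : ℝ) ^ (-α)) ^ k * (M.centralBinom / 4 ^ M)) : ℝ) : ℂ) else 0 := by
  have hδ : Tendsto (fun K : ℕ => |c| * (1 - (2 : ℝ) ^ (-α))⁻¹ * ((2 : ℝ) ^ (-α)) ^ K) atTop
      (𝓝 0) := by
    have := (tendsto_pow_atTop_nhds_zero_of_lt_one (by positivity)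
      (rpow_neg_lt_one hα)).const_mul (|c| * (1 - (2 : ℝ) ^ (-α))⁻¹)
    rwa [mul_zero] at this
  have hA := tendsto_inner_aeval inner_hilbertEven hilbertEven_opA hc hδ
    (fun K s hs => abs_lacunaryFn_sub_le hα hM K hs) (evenFn n) (evenFn m)
  have hB := tendsto_inner_aeval inner_subtypeL subtypeL_opB hc hδ
    (fun K s hs => abs_lacunaryFn_sub_le hα hM K hs) (evenFn n) (evenFn m)
  have hnm' : ((n : ℤ) + m + 1) = (2 * M + 1) * b := by exact_mod_cast hnm
  have hval : ∀ K, inner ℂ (evenFn m) (Polynomial.aeval opA (lacunaryPoly α c M K) (evenFn n)) -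
      inner ℂ (evenFn m) (Polynomial.aeval opB (lacunaryPoly α c M K) (evenFn n)) =
      ∑ k ∈ Finset.range K, if 2 ^ k = b then
        ((2 * Real.pi * (c * ((2 : ℝ) ^ (-α)) ^ k * (M.centralBinom / 4 ^ M)) : ℝ) : ℂ) else 0 := by
    intro K
    have sA := inner_aeval_sum opA (fun k => c * ((2 : ℝ) ^ (-α)) ^ k)
      (fun k => cutChebyshev M ((2 * M + 1) * 2 ^ k)) K (evenFn n) (evenFn m)
    have sB := inner_aeval_sum opB (fun k => c * ((2 : ℝ) ^ (-α)) ^ k)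
      (fun k => cutChebyshev M ((2 * M + 1) * 2 ^ k)) K (evenFn n) (evenFn m)
    refine (congrArg₂ (· - ·) sA sB).trans ?_
    rw [← Finset.sum_sub_distrib]
    refine Finset.sum_congr rfl fun k _ => ?_
    have h1 := inner_aeval_sub (cutChebyshev M ((2 * M + 1) * 2 ^ k)) n m
    rw [hnm', integral_cutChebyshev M (by positivity : 0 < 2 ^ k) hb] at h1
    rw [← mul_sub]
    refine (congrArg _ h1).trans ?_
    split_ifs
    · push_cast
      ring
    · rw [mul_zero]
  have hlim := hA.sub hB
  rw [sub_apply, inner_sub_right]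
  refine tendsto_nhds_unique (hlim.congr hval) (Summable.hasSum ?_).tendsto_sum_nat
  refine summable_of_hasFiniteSupport ((finite_Iic b).subset fun k hk => ?_)
  by_contra hkb
  refine hk (if_neg fun h => ?_)
  have : k < 2 ^ k := Nat.lt_two_pow_self
  simp only [mem_Iic, not_le] at hkb
  omega

/-- The dyadic block `2 ^ k ~ n` of the lacunary series produces an `(n + 1)`-dimensional diagonal
block of `h(A) - h(B)`, which bounds `s_n` from below. -/
theorem le_singularValue_lacunaryFn (hα : 0 < α) (hM : 0 < M) (hc0 : 0 ≤ c)
    (hc : Continuous (lacunaryFn α c M)) {n k : ℕ} (hk : 2 * n < 2 ^ k) :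
    c * ((2 : ℝ) ^ (-α)) ^ k * (M.centralBinom / 4 ^ M) ≤
      singularValue (opFun (lacunaryFn α c M) opA - opFun (lacunaryFn α c M) opB) n := by
  have h2π : (0 : ℝ) < 2 * Real.pi := by positivity
  have hd : 0 < 2 * M + 1 := by omega
  have key := le_singularValue
    (opFun (lacunaryFn α c M) opA - opFun (lacunaryFn α c M) opB) n
    (u := fun i => evenFn ((2 * M + 1) * i))
    (v := fun j => evenFn ((2 * M + 1) * (2 ^ k - j) - 1)) h2π
    (c := 2 * Real.pi * (c * ((2 : ℝ) ^ (-α)) ^ k * (M.centralBinom / 4 ^ M)))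
    (by positivity) ?_ ?_ ?_
  · rwa [mul_div_cancel_left₀ _ h2π.ne'] at key
  · intro i j
    rw [inner_evenFn]
    simp only [Nat.mul_right_inj hd.ne', Fin.val_inj, eq_comm (a := j)]
    push_cast
    rfl
  · intro i j
    rw [inner_evenFn]
    have hi := i.2
    have hj := j.2
    have h : (2 * M + 1) * (2 ^ k - j) - 1 = (2 * M + 1) * (2 ^ k - i) - 1 ↔ i = j := by
      refine ⟨fun h => ?_, fun h => by rw [h]⟩
      have h1 : 0 < (2 * M + 1) * (2 ^ k - (j : ℕ)) := Nat.mul_pos hd (by omega)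
      have h2 : 0 < (2 * M + 1) * (2 ^ k - (i : ℕ)) := Nat.mul_pos hd (by omega)
      have h3 := Nat.eq_of_mul_eq_mul_left hd
        (show (2 * M + 1) * (2 ^ k - (j : ℕ)) = (2 * M + 1) * (2 ^ k - (i : ℕ)) by omega)
      exact Fin.ext (by omega)
    simp only [h]
    push_cast
    rfl
  · intro i j
    have hi := i.2
    have hj := j.2
    have h1 : 0 < (2 * M + 1) * (2 ^ k - (j : ℕ)) := Nat.mul_pos hd (by omega)
    rw [inner_opFun_lacunaryFn hα hM hc (b := i + (2 ^ k - j)) (by omega)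
      (by rw [mul_add]; omega)]
    -- `2 ^ l = 2 ^ k + i - j` with `|i - j| ≤ n < 2 ^ (k - 1)` forces `l = k`.
    have hl : ∀ l, 2 ^ l = i + (2 ^ k - (j : ℕ)) ↔ l = k ∧ i = j := by
      intro l
      refine ⟨fun h => ?_, fun ⟨h, h'⟩ => by subst h h'; omega⟩
      have hlk : l = k := by
        rcases lt_trichotomy l k with hlt | heq | hgt
        · have := Nat.pow_le_pow_right two_pos (Nat.succ_le_of_lt hlt)
          rw [Nat.succ_eq_add_one, pow_succ] at this
          omega
        · exact heq
        · have := Nat.pow_le_pow_right two_pos (Nat.succ_le_of_lt hgt)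
          rw [Nat.succ_eq_add_one, pow_succ] at this
          omega
      subst hlk
      exact ⟨rfl, Fin.ext (by omega)⟩
    simp only [hl]
    by_cases hij : i = j
    · simp only [hij, and_true, if_true]
      rw [tsum_ite_eq]
    · simp [hij]

end HilbertSharpness

end

theorem mainTheorem10 (α : ℝ) (hα : 0 < α) :
    IsSelfAdjoint HilbertSharpness.opA ∧ IsSelfAdjoint HilbertSharpness.opB ∧
    ((HilbertSharpness.opA - HilbertSharpness.opB :
        HilbertSharpness.evenL2 →L[ℂ] HilbertSharpness.evenL2) :
      HilbertSharpness.evenL2 →ₗ[ℂ] HilbertSharpness.evenL2).rank = 1 ∧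
    ∃ h : ℝ → ℝ, (∃ C : ℝ, ∀ x, |h x| ≤ C) ∧ HilbertSharpness.MemHolderZygmund α h ∧
      ∀ n : ℕ, ((n : ℝ) + 1) ^ (-α) ≤
        HilbertSharpness.singularValue
          (HilbertSharpness.opFun h HilbertSharpness.opA -
            HilbertSharpness.opFun h HilbertSharpness.opB) n := by
  refine ⟨HilbertSharpness.isSelfAdjoint_opA, HilbertSharpness.isSelfAdjoint_opB,
    HilbertSharpness.rank_opA_sub_opB, ?_⟩
  set M := ⌊α⌋₊ + 2 with hM
  set b : ℝ := M.centralBinom / 4 ^ M with hb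
  have hb0 : 0 < b := by
    have := Nat.centralBinom_pos M
    positivity
  -- The factor `4 ^ α` absorbs the passage from `n + 1` to the dyadic scale `2 ^ k ≤ 4 (n + 1)`.
  set c : ℝ := 4 ^ α / b with hc
  have hc0 : 0 ≤ c := by positivity
  have hmem := HilbertSharpness.memHolderZygmund_lacunaryFn hα c
  refine ⟨HilbertSharpness.lacunaryFn α c M,
    ⟨_, HilbertSharpness.abs_lacunaryFn_le hα (by omega)⟩, hmem, fun n => ?_⟩
  obtain ⟨k, hk1, hk2⟩ : ∃ k, 2 * n < 2 ^ k ∧ 2 ^ k ≤ 4 * (n + 1) := by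
    have h1 := Nat.lt_pow_succ_log_self one_lt_two (n + 1)
    have h2 := Nat.pow_log_le_self 2 (Nat.succ_ne_zero n)
    refine ⟨Nat.log 2 (n + 1) + 2, ?_, ?_⟩
    · rw [pow_succ] at h1 ⊢
      rw [pow_succ]
      omega
    · rw [pow_succ, pow_succ]
      simp only [Nat.succ_eq_add_one] at h2
      omega
  refine le_trans ?_ (HilbertSharpness.le_singularValue_lacunaryFn hα (by omega) hc0 hmem.1 hk1)
  have e1 : c * ((2 : ℝ) ^ (-α)) ^ k * b = 4 ^ α * ((2 : ℝ) ^ (-α)) ^ k := by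
    rw [hc]
    field_simp
  have e2 : ((2 : ℝ) ^ (-α)) ^ k = ((2 : ℝ) ^ k) ^ (-α) := by
    rw [← Real.rpow_natCast, ← Real.rpow_natCast, ← Real.rpow_mul zero_le_two,
      ← Real.rpow_mul zero_le_two, mul_comm]
  rw [e1, e2]
  have h3 : (2 : ℝ) ^ k ≤ 4 * ((n : ℝ) + 1) := by exact_mod_cast hk2
  have h4 : (4 * ((n : ℝ) + 1)) ^ (-α) ≤ ((2 : ℝ) ^ k) ^ (-α) :=
    Real.rpow_le_rpow_of_nonpos (by positivity) h3 (by linarith)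
  calc ((n : ℝ) + 1) ^ (-α) = 4 ^ α * (4 * ((n : ℝ) + 1)) ^ (-α) := by
        rw [Real.mul_rpow (by norm_num) (by positivity), ← mul_assoc,
          ← Real.rpow_add (by norm_num), add_neg_cancel, Real.rpow_zero, one_mul]
    _ ≤ _ := mul_le_mul_of_nonneg_left h4 (by positivity)
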